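/- **Estimation error bound of MCUL.** Let $K\ge 2$, let $\mathcal X$ be the feature space and let $p(x,y)$ be a probability law on $\mathcal X\times\{1,\dots,K\}$ with marginal $p(x)$ on $\mathcal X$. For $c=1,\dots,K-1$ let $\overline p_c$ be the law on pairs $(x,\overline Y)$, $\overline Y\subseteq\{1,\dots,K\}$, $|\overline Y|=c$, given by $$\overline p_c(x,\overline Y)=\binom{K-1}{c}^{-1}\sum_{y\notin\overline Y}p(x,y).$$ Let $\mathcal G$ be a class of measurable functions $\mathcal X\to\mathbb R$ that has a countable subclass such that every member of $\mathcal G$ is a pointwise limit of a sequence from it, and let $\mathcal G^K$ be the class of all $g=(g_1,\dots,g_K):\mathcal X\to\mathbb R^K$ with all $g_k\in\mathcal G$. Let $$\mathfrak R_n(\mathcal G)=\mathbb E_{x_1,\dots,x_n\sim p(x)}\,\mathbb E_\sigma\Big[\sup_{g\in\mathcal G}\frac1n\sum_{i=1}^n\sigma_i g(x_i)\Big]$$ ($x_i$ i.i.d., $\sigma$ uniform on $\{-1,1\}^n$) be its Rademacher complexity, and suppose $\mathfrak R_n(\mathcal G)\le C_{\mathcal G}/\sqrt n$ for all $n\ge1$.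 Let $\ell:\mathbb R^K\times\{1,\dots,K\}\to[0,\infty)$ be a loss such that $\ell(g(x),y)\le C_\ell$ for all $g\in\mathcal G^K$, $x\in\mathcal X$ and all $y$, and such that each $\ell(\cdot,y)$ is Lipschitz with constant $L_\ell$ for the Euclidean norm. Put $R(g)=\mathbb E_{p(x,y)}[\ell(g(x),y)]$, $\mathcal L(z)=\sum_{y=1}^K\ell(z,y)$, and let $g^*$ be a minimizer of $R$ over $\mathcal G^K$. Let $\gamma\in[0,1]$, $\alpha_c\ge0$, $\sum_{c=1}^{K-1}\alpha_c=1$, and $n_u,n_1,\dots,n_{K-1}\ge1$. Let $x^u_1,\dots,x^u_{n_u}$ be i.i.d. from $p(x)$ and, for each $c$, let $(x^c_1,\overline Y^c_1),\dots,(x^c_{n_c},\overline Y^c_{n_c})$ be i.i.d. from $\overline p_c$. Define the empirical MCUL risk $$\hat R_{\rm MCUL}(g)=\frac{\gamma}{n_u}\sum_{i=1}^{n_u}\mathcal L(g(x^u_i))+\sum_{c=1}^{K-1}\frac{\alpha_c(1-\gamma)}{n_c}\sum_{i=1}^{n_c}\mathcal L(g(x^c_i))-\sum_{c=1}^{K-1}\frac{\alpha_c(K-1)}{c\,n_c}\sum_{i=1}^{n_c}\sum_{y\in\overline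 Y^c_i}\ell(g(x^c_i),y).$$ Then for every $\delta>0$, with probability at least $1-\delta$, every minimizer $\hat g_{\rm MCUL}$ of $\hat R_{\rm MCUL}$ over $\mathcal G^K$ satisfies both $$R(\hat g_{\rm MCUL})-R(g^*)\le 2K\Big[\gamma\Big(2KL_\ell\mathfrak R_{n_u}(\mathcal G)+C_\ell\sqrt{\tfrac{\ln(2K/\delta)}{2n_u}}\Big)+\sum_{c=1}^{K-1}\Big(\tfrac{K-1}{c}+1-\gamma\Big)\alpha_c\Big(2KL_\ell\mathfrak R_{n_c}(\mathcal G)+C_\ell\sqrt{\tfrac{\ln(2K/\delta)}{2n_c}}\Big)\Big]$$ and $$R(\hat g_{\rm MCUL})-R(g^*)\le M\Big(\frac1{\sqrt{n_u}}+\sum_{c=1}^{K-1}\frac1{\sqrt{n_c}}\Big),$$ where the constant $M$ depends only on $K$, $L_\ell$, $C_\ell$, $C_{\mathcal G}$ and $\delta$. -/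

import Mathlib

open MeasureTheory ProbabilityTheory Filter
open scoped NNReal ENNReal Topology

namespace MCUL

section Risk

variable {X : Type*} {K : ℕ}

/-- The product class `G^K`: the decision functions `g : X → ℝ^K` all of whose coordinate
functions belong to `G`. -/
def productClass (K : ℕ) (G : Set (X → ℝ)) : Set (X → EuclideanSpace ℝ (Fin K)) :=
  {g | ∀ k : Fin K, (fun x => g x k) ∈ G}

/-- The cumulative loss `𝓛(z) = ∑_y ℓ(z, y)`. -/
noncomputable def cumulativeLoss (ℓ : EuclideanSpace ℝ (Fin K) → Fin K → ℝ)
    (z : EuclideanSpace ℝ (Fin K)) : ℝ :=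
  ∑ y : Fin K, ℓ z y

/-- The classification risk `R(g) = E_{(x,y) ∼ D} ℓ(g(x), y)`. -/
noncomputable def risk [MeasurableSpace X] (D : Measure (X × Fin K))
    (ℓ : EuclideanSpace ℝ (Fin K) → Fin K → ℝ) (g : X → EuclideanSpace ℝ (Fin K)) : ℝ :=
  ∫ p, ℓ (g p.1) p.2 ∂D

/-- The empirical MCUL risk of `g` on unlabeled points `xu 0, …, xu (nu - 1)` and, for each
`c = 1, …, K - 1`, on points with complementary-label sets `z c 0, …, z c (n c - 1)`. -/
noncomputable def empiricalRisk (ℓ : EuclideanSpace ℝ (Fin K) → Fin K → ℝ) (γ : ℝ) (α : ℕ → ℝ)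
    {nu : ℕ} (xu : Fin nu → X) {n : ℕ → ℕ} (z : (c : ℕ) → Fin (n c) → X × Finset (Fin K))
    (g : X → EuclideanSpace ℝ (Fin K)) : ℝ :=
  γ / nu * ∑ i : Fin nu, cumulativeLoss ℓ (g (xu i))
  + ∑ c ∈ Finset.Icc 1 (K - 1), α c * (1 - γ) / n c *
      ∑ i : Fin (n c), cumulativeLoss ℓ (g (z c i).1)
  - ∑ c ∈ Finset.Icc 1 (K - 1), α c * ((K : ℝ) - 1) / (c * n c) *
      ∑ i : Fin (n c), ∑ y ∈ (z c i).2, ℓ (g (z c i).1) y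

/-- `g` minimizes the functional `F` over the class `𝓖`. -/
def IsMinimizer (F : (X → EuclideanSpace ℝ (Fin K)) → ℝ)
    (𝓖 : Set (X → EuclideanSpace ℝ (Fin K))) (g : X → EuclideanSpace ℝ (Fin K)) : Prop :=
  g ∈ 𝓖 ∧ ∀ g' ∈ 𝓖, F g ≤ F g'

end Risk

section Law

variable {X : Type*} [MeasurableSpace X] {K : ℕ}

/-- The marginal law `p(x)` of the instance. -/
noncomputable def marginal (D : Measure (X × Fin K)) : Measure X :=
  D.map Prod.fst

/-- The measure `p(·, y)` on the feature space (of total mass the probability of class `y`). -/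
noncomputable def classMeasure (D : Measure (X × Fin K)) (y : Fin K) : Measure X :=
  (D.restrict (Prod.snd ⁻¹' {y})).map Prod.fst

/-- The law `p̄_c` of an instance with a complementary-label set of size `c`: on each
`Y` with `|Y| = c` it is `p̄_c(·, Y) = (∑_{y ∉ Y} p(·, y)) / (K - 1 choose c)`. -/
noncomputable def compLaw (D : Measure (X × Fin K)) (c : ℕ) : Measure (X × Finset (Fin K)) :=
  ∑ Y ∈ Finset.powersetCard c (Finset.univ : Finset (Fin K)),
    (((Nat.choose (K - 1) c : ℝ≥0∞)⁻¹) • ∑ y ∈ Yᶜ, classMeasure D y).map (fun x => (x, Y))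

end Law

section Rademacher

variable {X : Type*}

/-- Empirical Rademacher complexity `E_σ sup_{g ∈ G} (1/n) ∑ σ_i g(x_i)`, with `σ` uniform on
`{-1, 1}^n`; it takes values in the extended reals as the suprema may be infinite.
It is nonnegative for nonempty `G`, as `σ` and `-σ` have the same law. -/
noncomputable def empiricalRademacher (G : Set (X → ℝ)) {n : ℕ} (x : Fin n → X) : EReal :=
  (∑ σ : Fin n → ℤˣ,
    ⨆ g ∈ G, ((1 / (n : ℝ) * ∑ i : Fin n, ((σ i : ℤ) : ℝ) * g (x i) : ℝ) : EReal))
    / (((2 : ℝ) ^ n : ℝ) : EReal)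

/-- Rademacher complexity `ℜ_n(G)` for samples of size `n` from `μ`. -/
noncomputable def rademacher [MeasurableSpace X] (μ : Measure X) (G : Set (X → ℝ)) (n : ℕ) :
    ℝ≥0∞ :=
  ∫⁻ x, (empiricalRademacher G x).toENNReal ∂(Measure.pi fun _ : Fin n => μ)

/-- The usual measurability condition on a function class: its members are measurable and all of
them are pointwise limits of sequences from one countable subclass. -/
def PointwiseMeasurable [MeasurableSpace X] (G : Set (X → ℝ)) : Prop :=
  (∀ g ∈ G, Measurable g) ∧
  ∃ G₀ ⊆ G, G₀.Countable ∧ ∀ g ∈ G, ∃ u : ℕ → X → ℝ,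
    (∀ m, u m ∈ G₀) ∧ ∀ x, Tendsto (fun m => u m x) atTop (𝓝 (g x))

end Rademacher

/-- The explicit estimation error bound. -/
noncomputable def errorBound {X : Type*} [MeasurableSpace X] (K : ℕ) (μ : Measure X)
    (G : Set (X → ℝ)) (L C γ : ℝ) (α : ℕ → ℝ) (nu : ℕ) (n : ℕ → ℕ) (δ : ℝ) : ℝ :=
  2 * K * (γ * (2 * K * L * (rademacher μ G nu).toReal
        + C * √(Real.log (2 * K / δ) / (2 * nu)))
    + ∑ c ∈ Finset.Icc 1 (K - 1), (((K : ℝ) - 1) / c + 1 - γ) * α c *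
        (2 * K * L * (rademacher μ G (n c)).toReal
          + C * √(Real.log (2 * K / δ) / (2 * n c))))

end MCUL

/-! The MCUL risk is an unbiased estimate of `R`. Under the law `p̄_c` the instance has marginal
`p(x)`, and each label other than the true class lies in the complementary set with conditional
probability `c/(K-1)`. Hence the loss summed over that set has mean `c/(K-1) · (E 𝓛 - R)`, and for
every single `c` the combination `(1-γ)𝓛 - (K-1)/c · ∑_{y ∈ Y} ℓ` has mean `R - γ E 𝓛`
(`integral_compLaw_sum_mem`, `risk_eq`).

For an empirical minimizer `ĝ`, `R(ĝ) - R(g*) ≤ [R(ĝ) - R̂(ĝ)] + [R̂(g*) - R(g*)]`. The first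
bracket needs a deviation bound uniform over the class, but only on one side; the second concerns
one fixed function, so Hoeffding's inequality suffices. Each of the `K` samples thus costs two
events of probability `δ/(2K)`, and a union bound, which needs no independence between different
samples, gives `δ`.

The uniform bound (`exists_productClass_deviation_le`) combines McDiarmid's inequality,
symmetrization (a factor 2) and a vector contraction principle for `Λ`-Lipschitz images of `G^K`.
Contraction replaces each loss sign by `K` independent signs, one per coordinate; its factor `2Λ`
comes from Khintchine's inequality with constant 2. Together they give `4ΛK ℜ_n`, and with `Λ = KL`
times the weight this is exactly the coefficient in `errorBound`. Suprema are taken over the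
countable subclass, where they are measurable; the resulting inequality passes to all of `G^K` by
dominated convergence. -/

namespace MCUL

/-! ### McDiarmid's inequality through moment generating functions. -/

section BoundedDifferences

variable {Z : Type*} [MeasurableSpace Z] (μ : Measure Z) [IsProbabilityMeasure μ]

/-- The centred moment generating function of a function of independent variables with bounded
differences. -/
theorem integral_exp_le_of_bounded_differences {c : ℝ} (t : ℝ) :
    ∀ {n : ℕ} (F : (Fin n → Z) → ℝ), Measurable F → (∃ B, ∀ x, |F x| ≤ B) →
      (∀ x i y, F (Function.update x i y) ≤ F x + c) →
      ∫ x, Real.exp (t * (F x - ∫ y, F y ∂Measure.pi fun _ : Fin n => μ))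
        ∂(Measure.pi fun _ : Fin n => μ) ≤ Real.exp (n * (c ^ 2 / 4) * t ^ 2 / 2) := by
  intro n
  induction n with
  | zero =>
    intro F hF _ _
    have : ∀ x : Fin 0 → Z, F x = F default := fun x => by rw [Subsingleton.elim x default]
    simp [this]
  | succ n ih =>
    intro F hF ⟨B, hB⟩ hd
    set π := Measure.pi fun _ : Fin n => μ with hπ
    have hmp := (measurePreserving_piFinSuccAbove (fun _ : Fin (n + 1) => μ) 0).symm
    have hsymm (p : Z × (Fin n → Z)) :
        (MeasurableEquiv.piFinSuccAbove (fun _ : Fin (n + 1) => Z) 0).symm p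
          = Fin.cons p.1 p.2 := Fin.insertNth_zero' _ _
    have key : ∀ G : (Fin (n + 1) → Z) → ℝ, Measurable G → (∃ B, ∀ x, |G x| ≤ B) →
        ∫ x, G x ∂(Measure.pi fun _ : Fin (n + 1) => μ)
          = ∫ a, ∫ x, G (Fin.cons a x) ∂π ∂μ := by
      intro G hG ⟨B, hB⟩
      rw [← hmp.integral_comp', integral_prod]
      · simp only [hsymm]
        rfl
      · refine Integrable.of_bound (C := B) ?_ (ae_of_all _ fun x => ?_)
        · exact (hG.comp (MeasurableEquiv.measurable _)).aestronglyMeasurable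
        · exact hB _
    have hcons : Measurable fun p : Z × (Fin n → Z) => (Fin.cons p.1 p.2 : Fin (n + 1) → Z) := by
      have hm := (MeasurableEquiv.piFinSuccAbove (fun _ : Fin (n + 1) => Z) 0).symm.measurable
      rw [funext hsymm] at hm
      exact hm
    have hconsa (a : Z) : Measurable fun x : Fin n → Z => (Fin.cons a x : Fin (n + 1) → Z) :=
      hcons.comp measurable_prodMk_left
    have hint (a : Z) : Integrable (fun x => F (Fin.cons a x)) π :=
      Integrable.of_bound (C := B) (hF.comp (hconsa a)).aestronglyMeasurable
        (ae_of_all _ fun x => hB _)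
    -- Averaging over all coordinates but the first gives the first martingale increment `h a - m`.
    -- The averages inherit the oscillation bound `c`, while the inductive hypothesis treats `F
    -- (cons a ·)` around its own mean `h a`.
    set h : Z → ℝ := fun a => ∫ x, F (Fin.cons a x) ∂π with hh
    have hhm : Measurable h :=
      ((hF.comp hcons).stronglyMeasurable.integral_prod_right').measurable
    have hosc (a b : Z) : h b ≤ h a + c := by
      have : h a + c = ∫ x, (F (Fin.cons a x) + c) ∂π := by
        rw [integral_add (hint a) (integrable_const _)]; simp [hh]
      rw [this]
      refine integral_mono (hint b) ((hint a).add (integrable_const _)) fun x => ?_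
      have := hd (Fin.cons a x) 0 b
      rwa [Fin.update_cons_zero] at this
    have hhB (a : Z) : |h a| ≤ B := by
      have := norm_integral_le_of_norm_le_const (μ := π) (f := fun x => F (Fin.cons a x))
        (ae_of_all _ fun x => hB _)
      simpa using this
    have hm : ∫ y, F y ∂(Measure.pi fun _ : Fin (n + 1) => μ) = ∫ a, h a ∂μ :=
      key F hF ⟨B, hB⟩
    set m := ∫ a, h a ∂μ with hmdef
    have hexp : ∀ s : ℝ, |s| ≤ B + |m| → |Real.exp (t * s)| ≤ Real.exp (|t| * (B + |m|)) := by
      intro s hs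
      rw [Real.abs_exp, Real.exp_le_exp]
      exact (le_abs_self _).trans (by rw [abs_mul]; gcongr)
    have hFm (x) : |F x - m| ≤ B + |m| := (abs_sub _ _).trans (by gcongr; exact hB x)
    rw [hm, key _ (by fun_prop) ⟨_, fun x => hexp _ (hFm x)⟩]
    -- Hoeffding's lemma: `h` takes values in an interval of length `c` starting at its infimum, so
    -- its variance proxy is `c ^ 2 / 4`.
    have hoef := hasSubgaussianMGF_of_mem_Icc (μ := μ) (X := h) (a := ⨅ a, h a)
      (b := (⨅ a, h a) + c) hhm.aemeasurable (ae_of_all _ fun a => by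
        have hbdd : BddBelow (Set.range h) := ⟨-B, by
          rintro _ ⟨a, rfl⟩; exact (abs_le.1 (hhB a)).1⟩
        have : Nonempty Z := ⟨a⟩
        refine ⟨ciInf_le hbdd a, ?_⟩
        rw [← sub_le_iff_le_add]
        exact le_ciInf fun b => by linarith [hosc b a])
    have hoef' := hoef.mgf_le t
    have hcc : (((‖(⨅ a, h a) + c - ⨅ a, h a‖₊ / 2) ^ 2 : ℝ≥0) : ℝ) = c ^ 2 / 4 := by
      push_cast; rw [add_sub_cancel_left, Real.norm_eq_abs, div_pow, sq_abs]; norm_num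
    rw [hcc, mgf] at hoef'
    have inner (a : Z) : ∫ x, Real.exp (t * (F (Fin.cons a x) - m)) ∂π
        ≤ Real.exp (n * (c ^ 2 / 4) * t ^ 2 / 2) * Real.exp (t * (h a - m)) := by
      have h1 := ih (fun x => F (Fin.cons a x)) (hF.comp (hconsa a)) ⟨B, fun x => hB _⟩
        (fun x i y => by
          have := hd (Fin.cons a x) i.succ y
          rwa [← Fin.cons_update] at this)
      calc ∫ x, Real.exp (t * (F (Fin.cons a x) - m)) ∂π
          = ∫ x, Real.exp (t * (F (Fin.cons a x) - h a)) * Real.exp (t * (h a - m)) ∂π := by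
            congr 1; ext x; rw [← Real.exp_add]; congr 1; ring
        _ = (∫ x, Real.exp (t * (F (Fin.cons a x) - h a)) ∂π) * Real.exp (t * (h a - m)) :=
            integral_mul_const _ _
        _ ≤ _ := by gcongr
    calc ∫ a, ∫ x, Real.exp (t * (F (Fin.cons a x) - m)) ∂π ∂μ
        ≤ ∫ a, Real.exp (n * (c ^ 2 / 4) * t ^ 2 / 2) * Real.exp (t * (h a - m)) ∂μ := by
          refine integral_mono_of_nonneg (ae_of_all _ fun a => integral_nonneg fun x =>
            (Real.exp_pos _).le) ?_ (ae_of_all _ inner)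
          exact (hoef.integrable_exp_mul t).const_mul _
      _ = Real.exp (n * (c ^ 2 / 4) * t ^ 2 / 2) * ∫ a, Real.exp (t * (h a - m)) ∂μ :=
          integral_const_mul _ _
      _ ≤ Real.exp (n * (c ^ 2 / 4) * t ^ 2 / 2) * Real.exp (c ^ 2 / 4 * t ^ 2 / 2) := by gcongr
      _ = _ := by rw [← Real.exp_add]; congr 1; push_cast; ring

/-- **McDiarmid's bounded differences inequality**. -/
theorem measureReal_ge_le_of_bounded_differences {n : ℕ} (hn : 1 ≤ n) {W q : ℝ} (hW : 0 < W)
    (hq : 0 ≤ q) (F : (Fin n → Z) → ℝ) (hF : Measurable F) (hB : ∃ B, ∀ x, |F x| ≤ B)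
    (hd : ∀ x i y, F (Function.update x i y) ≤ F x + W / n) :
    (Measure.pi fun _ : Fin n => μ).real
      {x | W * √(q / (2 * n)) ≤ F x - ∫ y, F y ∂Measure.pi fun _ : Fin n => μ}
      ≤ Real.exp (-q) := by
  have hn' : (0 : ℝ) < n := by exact_mod_cast hn
  set π := Measure.pi fun _ : Fin n => μ
  -- With increments `W / n` the proxy is `W ^ 2 / (4 * n)`, so the Chernoff bound at `W * √(q / (2
  -- * n))` has exponent exactly `-q`.
  have hsub : HasSubgaussianMGF (fun x => F x - ∫ y, F y ∂π)
      ⟨n * ((W / n) ^ 2 / 4), by positivity⟩ π := by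
    obtain ⟨B, hB⟩ := hB
    refine ⟨fun t => ?_, fun t => ?_⟩
    · refine Integrable.of_bound (C := Real.exp (|t| * (B + |∫ y, F y ∂π|))) ?_
        (ae_of_all _ fun x => ?_)
      · exact (by fun_prop : Measurable fun x =>
          Real.exp (t * (F x - ∫ y, F y ∂π))).aestronglyMeasurable
      · rw [Real.norm_eq_abs, Real.abs_exp, Real.exp_le_exp]
        refine (le_abs_self _).trans ?_
        rw [abs_mul]
        gcongr
        exact (abs_sub _ _).trans (by gcongr; exact hB x)
    · exact integral_exp_le_of_bounded_differences μ t F hF ⟨B, hB⟩ hd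
  refine (hsub.measure_ge_le (ε := W * √(q / (2 * n))) (by positivity)).trans_eq ?_
  congr 1
  rw [mul_pow, Real.sq_sqrt (by positivity)]
  change _ / (2 * (n * ((W / n) ^ 2 / 4))) = _
  field_simp
  ring

end BoundedDifferences

end MCUL

namespace MCUL

/-! ### Symmetrization by a ghost sample and random signs. -/

section Symmetrization

open scoped BigOperators

theorem bddAbove_range_of_abs_le {ι : Type*} {u : ι → ℝ} {B : ℝ} (h : ∀ i, |u i| ≤ B) :
    BddAbove (Set.range u) :=
  ⟨B, by rintro _ ⟨i, rfl⟩; exact (abs_le.1 (h i)).2⟩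

theorem abs_ciSup_le {ι : Type*} [Nonempty ι] {u : ι → ℝ} {B : ℝ} (h : ∀ i, |u i| ≤ B) :
    |⨆ i, u i| ≤ B := by
  refine abs_le.2 ⟨?_, ciSup_le fun i => (abs_le.1 (h i)).2⟩
  obtain ⟨i⟩ := ‹Nonempty ι›
  exact (abs_le.1 (h i)).1.trans (le_ciSup (bddAbove_range_of_abs_le h) i)

theorem abs_sign (s : ℤˣ) : |((s : ℤ) : ℝ)| = 1 := by
  rcases Int.units_eq_one_or s with rfl | rfl <;> simp

variable {Z : Type*} [MeasurableSpace Z] (μ : Measure Z) [IsProbabilityMeasure μ]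
  {ι : Type*} [Countable ι] [Nonempty ι]

theorem integral_expect {Ω α : Type*} [Fintype α] [Nonempty α] [MeasurableSpace Ω] (ν : Measure Ω)
    (F : α → Ω → ℝ) (hF : ∀ a, Integrable (F a) ν) :
    ∫ x, 𝔼 a, F a x ∂ν = 𝔼 a, ∫ x, F a x ∂ν := by
  simp only [Fintype.expect_eq_sum_div_card]
  rw [integral_div, integral_finsetSum _ fun a _ => hF a]

/-- **Symmetrization**: the expected one-sided uniform deviation is at most twice the Rademacher
average. -/
theorem integral_iSup_deviation_le {n : ℕ} {B : ℝ} (f : ι → Z → ℝ) (hf : ∀ i, Measurable (f i))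
    (hB : ∀ i z, |f i z| ≤ B) :
    ∫ x, ⨆ i, ∑ j, ((∫ z, f i z ∂μ) - f i (x j)) ∂(Measure.pi fun _ : Fin n => μ)
      ≤ 2 * ∫ x, 𝔼 σ : Fin n → ℤˣ, ⨆ i, ∑ j, ((σ j : ℤ) : ℝ) * f i (x j)
        ∂(Measure.pi fun _ : Fin n => μ) := by
  set π := Measure.pi fun _ : Fin n => μ with hπ
  set ρ := Measure.pi fun _ : Fin n => μ.prod μ with hρ
  have hsumB {u : Fin n → ℝ} {b : ℝ} (hu : ∀ j, |u j| ≤ b) : |∑ j, u j| ≤ n * b := by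
    refine (Finset.abs_sum_le_sum_abs _ _).trans ((Finset.sum_le_sum fun j _ => hu j).trans ?_)
    simp
  have hint {Ω : Type _} [MeasurableSpace Ω] (ν : Measure Ω) [IsProbabilityMeasure ν]
      {b : ℝ} (g : ι → Ω → ℝ) (hg : ∀ i, Measurable (g i)) (hb : ∀ i x, |g i x| ≤ b) :
      Integrable (fun x => ⨆ i, g i x) ν :=
    Integrable.of_bound (C := b) (Measurable.iSup hg).aestronglyMeasurable
      (ae_of_all _ fun x => abs_ciSup_le fun i => hb i x)
  have habs (i a b) : |f i a - f i b| ≤ B + B :=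
    (abs_sub _ _).trans (add_le_add (hB _ _) (hB _ _))
  have hsgn (s : ℤˣ) (i z) : |((s : ℤ) : ℝ) * f i z| ≤ B := by
    rw [abs_mul, abs_sign, one_mul]; exact hB i z
  set S : (Fin n → ℤˣ) → ℝ := fun σ => ∫ x, ⨆ i, ∑ j, ((σ j : ℤ) : ℝ) * f i (x j) ∂π with hS
  have hSint (σ : Fin n → ℤˣ) :
      Integrable (fun x : Fin n → Z => ⨆ i, ∑ j, ((σ j : ℤ) : ℝ) * f i (x j)) π :=
    hint π _ (fun i => by fun_prop) fun i x => hsumB fun j => hsgn (σ j) i (x j)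
  have hπint : ∫ x, 𝔼 σ : Fin n → ℤˣ, ⨆ i, ∑ j, ((σ j : ℤ) : ℝ) * f i (x j) ∂π = 𝔼 σ, S σ :=
    integral_expect _ _ hSint
  have hΨint : Integrable (fun p : (Fin n → Z) × (Fin n → Z) =>
      ⨆ i, ∑ j, (f i (p.2 j) - f i (p.1 j))) (π.prod π) :=
    hint _ _ (fun i => by fun_prop) fun i x => hsumB fun j => habs i _ _
  -- Ghost sample: the means are expectations over an independent copy, and a supremum of
  -- expectations is at most the expectation of the supremum.
  have h1 : ∫ x, ⨆ i, ∑ j, ((∫ z, f i z ∂μ) - f i (x j)) ∂π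
      ≤ ∫ p : (Fin n → Z) × (Fin n → Z), ⨆ i, ∑ j, (f i (p.2 j) - f i (p.1 j)) ∂(π.prod π) := by
    rw [integral_prod _ hΨint]
    refine integral_mono ?_ hΨint.integral_prod_left fun x => ciSup_le fun i => ?_
    · refine hint π (b := n * (B + B)) _ (fun i => by fun_prop) fun i x => hsumB fun j => ?_
      refine (abs_sub _ _).trans (add_le_add ?_ (hB _ _))
      simpa using norm_integral_le_of_norm_le_const (μ := μ) (f := f i) (ae_of_all _ (hB i))
    · have hev (j : Fin n) : ∫ x' : Fin n → Z, f i (x' j) ∂π = ∫ z, f i z ∂μ :=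
        integral_comp_eval (μ := fun _ : Fin n => μ) (hf i).aestronglyMeasurable
      have hevi (j : Fin n) : Integrable (fun x' : Fin n → Z => f i (x' j)) π :=
        Integrable.of_bound (C := B) (by fun_prop : Measurable fun x' : Fin n → Z =>
          f i (x' j)).aestronglyMeasurable (ae_of_all _ fun x => hB i _)
      have hevd (j : Fin n) : Integrable (fun x' : Fin n → Z => f i (x' j) - f i (x j)) π :=
        (hevi j).sub (integrable_const _)
      calc ∑ j, ((∫ z, f i z ∂μ) - f i (x j))
          = ∫ x' : Fin n → Z, ∑ j, (f i (x' j) - f i (x j)) ∂π := by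
            rw [integral_finsetSum _ fun j _ => hevd j]
            refine Finset.sum_congr rfl fun j _ => ?_
            rw [integral_sub (hevi j) (integrable_const _), hev]
            simp
        _ ≤ _ := by
            refine integral_mono ?_ ?_ fun x' => ?_
            · exact integrable_finsetSum _ fun j _ => hevd j
            · exact hint π _ (fun i => by fun_prop) fun i x' => hsumB fun j => habs i _ _
            · exact le_ciSup (f := fun i => ∑ j, (f i (x' j) - f i (x j)))
                (bddAbove_range_of_abs_le fun i => hsumB fun j => habs i _ _) i
  have h2 : ∫ p : (Fin n → Z) × (Fin n → Z), ⨆ i, ∑ j, (f i (p.2 j) - f i (p.1 j)) ∂(π.prod π)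
      = ∫ w, ⨆ i, ∑ j, (f i (w j).2 - f i (w j).1) ∂ρ := by
    rw [← (measurePreserving_arrowProdEquivProdArrow Z Z (Fin n) (fun _ => μ)
      (fun _ => μ)).integral_comp']
    rfl
  have h3 (σ : Fin n → ℤˣ) : ∫ w, ⨆ i, ∑ j, (f i (w j).2 - f i (w j).1) ∂ρ ≤ S σ + S (-σ) := by
    -- Swapping the two points of pair `j` whenever `σ j = -1` preserves the law and multiplies the
    -- `j`-th difference by `σ j`. The signed sum then splits into a `σ` part on the second points
    -- and a `-σ` part on the first.
    have hmp : MeasurePreserving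
        (fun (w : Fin n → Z × Z) j => (if σ j = 1 then id else Prod.swap) (w j)) ρ ρ := by
      refine measurePreserving_pi (fun _ => μ.prod μ) (fun _ => μ.prod μ)
        (f := fun j => if σ j = 1 then id else Prod.swap) fun j => ?_
      split_ifs
      · exact MeasurePreserving.id _
      · exact Measure.measurePreserving_swap
    have hmeas : Measurable fun w : Fin n → Z × Z => ⨆ i, ∑ j, (f i (w j).2 - f i (w j).1) :=
      Measurable.iSup fun i => by fun_prop
    have hfst : MeasurePreserving (fun (w : Fin n → Z × Z) j => (w j).1) ρ π :=
      measurePreserving_pi (fun _ => μ.prod μ) (fun _ => μ) fun _ => measurePreserving_fst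
    have hsnd : MeasurePreserving (fun (w : Fin n → Z × Z) j => (w j).2) ρ π :=
      measurePreserving_pi (fun _ => μ.prod μ) (fun _ => μ) fun _ => measurePreserving_snd
    have e1 : S σ = ∫ w, ⨆ i, ∑ j, ((σ j : ℤ) : ℝ) * f i (w j).2 ∂ρ := by
      simp only [hS]
      rw [← hsnd.map_eq, integral_map hsnd.aemeasurable]
      rw [hsnd.map_eq]; exact (hSint σ).aestronglyMeasurable
    have e2 : S (-σ) = ∫ w, ⨆ i, ∑ j, (((-σ) j : ℤ) : ℝ) * f i (w j).1 ∂ρ := by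
      simp only [hS]
      rw [← hfst.map_eq, integral_map hfst.aemeasurable]
      rw [hfst.map_eq]; exact (hSint (-σ)).aestronglyMeasurable
    have i1 : Integrable (fun w : Fin n → Z × Z => ⨆ i, ∑ j, ((σ j : ℤ) : ℝ) * f i (w j).2) ρ :=
      hint ρ _ (fun i => by fun_prop) fun i x => hsumB fun j => hsgn _ i _
    have i2 : Integrable
        (fun w : Fin n → Z × Z => ⨆ i, ∑ j, (((-σ) j : ℤ) : ℝ) * f i (w j).1) ρ :=
      hint ρ _ (fun i => by fun_prop) fun i x => hsumB fun j => hsgn _ i _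
    rw [e1, e2, ← integral_add i1 i2, ← hmp.map_eq, integral_map hmp.aemeasurable
      hmeas.aestronglyMeasurable, hmp.map_eq]
    refine integral_mono ?_ (i1.add i2) fun w => ciSup_le fun i => ?_
    · exact hint ρ _ (fun i => (by fun_prop : Measurable fun w : Fin n → Z × Z =>
        ∑ j, (f i (w j).2 - f i (w j).1)).comp hmp.measurable)
        fun i x => hsumB fun j => habs i _ _
    · refine le_trans (le_of_eq ?_) (add_le_add
        (le_ciSup (f := fun i => ∑ j, ((σ j : ℤ) : ℝ) * f i (w j).2)
          (bddAbove_range_of_abs_le fun i => hsumB fun j => hsgn _ i _) i)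
        (le_ciSup (f := fun i => ∑ j, (((-σ) j : ℤ) : ℝ) * f i (w j).1)
          (bddAbove_range_of_abs_le fun i => hsumB fun j => hsgn _ i _) i))
      rw [← Finset.sum_add_distrib]
      refine Finset.sum_congr rfl fun j _ => ?_
      rcases Int.units_eq_one_or (σ j) with h | h
      · simp [h]; ring
      · simp [h]; ring
  rw [hπint]
  refine h1.trans (h2.le.trans ?_)
  have h4 : ∫ w, ⨆ i, ∑ j, (f i (w j).2 - f i (w j).1) ∂ρ
      ≤ 𝔼 σ : Fin n → ℤˣ, (S σ + S (-σ)) := by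
    rw [← Fintype.expect_const (ι := Fin n → ℤˣ)
      (∫ w, ⨆ i, ∑ j, (f i (w j).2 - f i (w j).1) ∂ρ)]
    exact Finset.expect_le_expect fun σ _ => h3 σ
  refine h4.trans_eq ?_
  rw [Finset.expect_add_distrib, Fintype.expect_equiv (Equiv.neg _) (fun σ => S (-σ)) S
    fun σ => rfl]
  ring

end Symmetrization

end MCUL

namespace MCUL

/-! ### Khintchine's inequality and vector contraction. -/

section Contraction

open scoped BigOperators

theorem expect_fin_cons {α : Type*} [Fintype α] {n : ℕ} (F : (Fin (n + 1) → α) → ℝ) :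
    𝔼 σ, F σ = 𝔼 a, 𝔼 s : Fin n → α, F (Fin.cons a s) := by
  rw [← Finset.expect_product' Finset.univ Finset.univ fun a s => F (Fin.cons a s),
    Finset.univ_product_univ]
  exact (Fintype.expect_equiv (Fin.consEquiv fun _ => α) _ _ fun _ => rfl).symm

theorem expect_units_int (F : ℤˣ → ℝ) : 𝔼 s, F s = (F 1 + F (-1)) / 2 := by
  rw [Fintype.expect_eq_sum_div_card]
  simp

theorem expect_sq_sum_sign {K : ℕ} (z : Fin K → ℝ) :
    𝔼 ε : Fin K → ℤˣ, (∑ k, ((ε k : ℤ) : ℝ) * z k) ^ 2 = ∑ k, z k ^ 2 := by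
  induction K with
  | zero => simp
  | succ K ih =>
    have h (ε : Fin K → ℤˣ) :
        𝔼 a : ℤˣ, (((a : ℤ) : ℝ) * z 0 + ∑ k, ((ε k : ℤ) : ℝ) * z k.succ) ^ 2
          = z 0 ^ 2 + (∑ k, ((ε k : ℤ) : ℝ) * z k.succ) ^ 2 := by
      rw [expect_units_int]; push_cast; ring
    rw [expect_fin_cons, Finset.expect_comm]
    simp only [Fin.sum_univ_succ, Fin.cons_zero, Fin.cons_succ, h]
    rw [Finset.expect_add_distrib, Fintype.expect_const, ih]

/-- Peeling off the first sign kills the odd powers. With `S` the sum of the remaining squares, what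
is left is at most `z₀⁴ + 6 z₀² S + 3 S²`, which is below `3 (z₀² + S)²` by `2 z₀⁴`. This upper
bound on the fourth moment, set against the exact second moment, yields the lower bound on the first
moment in Khintchine's inequality. -/
theorem expect_pow_four_sum_sign_le {K : ℕ} (z : Fin K → ℝ) :
    𝔼 ε : Fin K → ℤˣ, (∑ k, ((ε k : ℤ) : ℝ) * z k) ^ 4 ≤ 3 * (∑ k, z k ^ 2) ^ 2 := by
  induction K with
  | zero => simp
  | succ K ih =>
    have h (ε : Fin K → ℤˣ) :
        𝔼 a : ℤˣ, (((a : ℤ) : ℝ) * z 0 + ∑ k, ((ε k : ℤ) : ℝ) * z k.succ) ^ 4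
          = z 0 ^ 4 + 6 * z 0 ^ 2 * (∑ k, ((ε k : ℤ) : ℝ) * z k.succ) ^ 2
            + (∑ k, ((ε k : ℤ) : ℝ) * z k.succ) ^ 4 := by
      rw [expect_units_int]; push_cast; ring
    rw [expect_fin_cons, Finset.expect_comm]
    simp only [Fin.sum_univ_succ, Fin.cons_zero, Fin.cons_succ, h]
    rw [Finset.expect_add_distrib, Finset.expect_add_distrib, Fintype.expect_const,
      ← Finset.mul_expect, expect_sq_sum_sign]
    have := ih fun k => z k.succ
    nlinarith [sq_nonneg (z 0 ^ 2)]

/-- **Khintchine's inequality** in `L¹`, with the constant `2`. -/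
theorem norm_le_two_mul_expect_abs {K : ℕ} (z : EuclideanSpace ℝ (Fin K)) :
    ‖z‖ ≤ 2 * 𝔼 ε : Fin K → ℤˣ, |∑ k, ((ε k : ℤ) : ℝ) * z k| := by
  have hz : ∑ k, z k ^ 2 = ‖z‖ ^ 2 := (EuclideanSpace.real_norm_sq_eq z).symm
  rcases (norm_nonneg z).eq_or_lt with h0 | hr
  · rw [← h0]
    exact mul_nonneg zero_le_two (Finset.expect_nonneg fun _ _ => abs_nonneg _)
  set r := ‖z‖
  -- An even quartic minorant of `|s|`, touching it at `0` and at `|s| = 2r`. Averaging with the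
  -- second and fourth moments gives `(3/4 - 3/16) r = 9/16 r`, more than the needed `r / 2`.
  have hpt (s : ℝ) : 3 / (4 * r) * s ^ 2 - 1 / (16 * r ^ 3) * s ^ 4 ≤ |s| := by
    have h1 : |s| - (3 / (4 * r) * s ^ 2 - 1 / (16 * r ^ 3) * s ^ 4)
        = |s| * (|s| - 2 * r) ^ 2 * (|s| + 4 * r) / (16 * r ^ 3) := by
      rw [← sq_abs s, show s ^ 4 = |s| ^ 4 by rw [← abs_pow, abs_of_nonneg (by positivity)]]
      field_simp
      ring
    have h2 : 0 ≤ |s| * (|s| - 2 * r) ^ 2 * (|s| + 4 * r) / (16 * r ^ 3) := by positivity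
    linarith
  have h := Finset.expect_le_expect (s := Finset.univ) fun (ε : Fin K → ℤˣ) _ =>
    hpt (∑ k, ((ε k : ℤ) : ℝ) * z k)
  rw [Finset.expect_sub_distrib, ← Finset.mul_expect, ← Finset.mul_expect,
    expect_sq_sum_sign, hz] at h
  have h4 : 1 / (16 * r ^ 3) * 𝔼 ε : Fin K → ℤˣ, (∑ k, ((ε k : ℤ) : ℝ) * z k) ^ 4
      ≤ 1 / (16 * r ^ 3) * (3 * (r ^ 2) ^ 2) := by
    rw [← hz]
    exact mul_le_mul_of_nonneg_left (expect_pow_four_sum_sign_le _) (by positivity)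
  have e1 : 3 / (4 * r) * r ^ 2 = 3 / 4 * r := by field_simp
  have e2 : 1 / (16 * r ^ 3) * (3 * (r ^ 2) ^ 2) = 3 / 16 * r := by field_simp
  rw [e2] at h4
  rw [e1] at h
  linarith

variable {ι : Type*} [Nonempty ι] {K : ℕ} {Λ : ℝ}

/-- One step of contraction. The average over a single sign is half a supremum over independent
pairs `(t, t')`, where the increment of `h` is at most `Λ ‖v t - v t'‖`, hence by Khintchine at most
`2Λ` times an average of absolute values. For each `ε` the absolute value is absorbed by using `t`
and `t'` with opposite signs `ε` and `-ε`, whose laws agree. Boundedness is part of the conclusion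
because an unbounded real supremum would be the default value `0`, and the induction must feed these
suprema back in. -/
theorem expect_iSup_add_sign_mul_le (hΛ : 0 ≤ Λ) (U h : ι → ℝ) (v : ι → EuclideanSpace ℝ (Fin K))
    (hL : ∀ t t', |h t - h t'| ≤ Λ * ‖v t - v t'‖)
    (hb : ∀ ε : Fin K → ℤˣ,
      BddAbove (Set.range fun t => U t + 2 * Λ * ∑ k, ((ε k : ℤ) : ℝ) * v t k)) :
    (∀ s : ℤˣ, BddAbove (Set.range fun t => U t + ((s : ℤ) : ℝ) * h t)) ∧
    𝔼 s : ℤˣ, ⨆ t, (U t + ((s : ℤ) : ℝ) * h t)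
      ≤ 𝔼 ε : Fin K → ℤˣ, ⨆ t, (U t + 2 * Λ * ∑ k, ((ε k : ℤ) : ℝ) * v t k) := by
  set A : (Fin K → ℤˣ) → ℝ := fun ε => ⨆ t, (U t + 2 * Λ * ∑ k, ((ε k : ℤ) : ℝ) * v t k) with hA
  have hneg : 𝔼 ε, A (-ε) = 𝔼 ε, A ε := Fintype.expect_equiv (Equiv.neg _) _ _ fun _ => rfl
  have hle (ε t) : U t + 2 * Λ * ∑ k, ((ε k : ℤ) : ℝ) * v t k ≤ A ε := le_ciSup (hb ε) t
  have hpair (t t') : (U t + h t) + (U t' - h t') ≤ 2 * 𝔼 ε, A ε := by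
    have h1 (ε : Fin K → ℤˣ) :
        U t + U t' + 2 * Λ * |∑ k, ((ε k : ℤ) : ℝ) * (v t - v t') k| ≤ A ε + A (-ε) := by
      have e (u : ι) : ∑ k, (((-ε) k : ℤ) : ℝ) * v u k = - ∑ k, ((ε k : ℤ) : ℝ) * v u k := by
        rw [← Finset.sum_neg_distrib]; simp
      have e' : ∑ k, ((ε k : ℤ) : ℝ) * (v t - v t') k
          = ∑ k, ((ε k : ℤ) : ℝ) * v t k - ∑ k, ((ε k : ℤ) : ℝ) * v t' k := by
        rw [← Finset.sum_sub_distrib]; simp [mul_sub]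
      have a1 := hle ε t
      have a2 := hle ε t'
      have a3 := hle (-ε) t
      have a4 := hle (-ε) t'
      rw [e] at a3 a4
      rw [e']
      rcases abs_cases (∑ k, ((ε k : ℤ) : ℝ) * v t k - ∑ k, ((ε k : ℤ) : ℝ) * v t' k)
        with ⟨h, _⟩ | ⟨h, _⟩ <;> rw [h] <;> linarith
    have h2 := Finset.expect_le_expect (s := Finset.univ) fun ε _ => h1 ε
    simp only [Finset.expect_add_distrib] at h2
    rw [hneg, Fintype.expect_const, Fintype.expect_const,
      ← Finset.mul_expect] at h2
    have h3 := (le_abs_self _).trans (hL t t')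
    have h4 := mul_le_mul_of_nonneg_left (norm_le_two_mul_expect_abs (v t - v t')) hΛ
    linarith
  have hbdd : ∀ s : ℤˣ, BddAbove (Set.range fun t => U t + ((s : ℤ) : ℝ) * h t) := by
    obtain ⟨t₀⟩ := ‹Nonempty ι›
    intro s
    rcases Int.units_eq_one_or s with rfl | rfl
    · refine ⟨2 * 𝔼 ε, A ε - (U t₀ - h t₀), ?_⟩
      rintro _ ⟨t, rfl⟩
      have := hpair t t₀
      simp only [Units.val_one, Int.cast_one, one_mul]
      linarith
    · refine ⟨2 * 𝔼 ε, A ε - (U t₀ + h t₀), ?_⟩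
      rintro _ ⟨t, rfl⟩
      have := hpair t₀ t
      simp only [Units.val_neg, Units.val_one, Int.cast_neg, Int.cast_one, neg_mul, one_mul]
      linarith
  refine ⟨hbdd, ?_⟩
  rw [expect_units_int, div_le_iff₀ zero_lt_two, mul_comm]
  refine ciSup_add_ciSup_le fun t t' => ?_
  have := hpair t t'
  simp only [Units.val_neg, Units.val_one, Int.cast_neg, Int.cast_one, neg_mul, one_mul]
  linarith

/-- **Vector contraction** for Rademacher averages. -/
theorem expect_iSup_le_of_lipschitz (hΛ : 0 ≤ Λ) {n : ℕ} (U : ι → ℝ) (h : Fin n → ι → ℝ)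
    (v : Fin n → ι → EuclideanSpace ℝ (Fin K))
    (hL : ∀ j t t', |h j t - h j t'| ≤ Λ * ‖v j t - v j t'‖)
    (hb : ∀ τ : Fin n → Fin K → ℤˣ,
      BddAbove (Set.range fun t => U t + 2 * Λ * ∑ j, ∑ k, ((τ j k : ℤ) : ℝ) * v j t k)) :
    𝔼 σ : Fin n → ℤˣ, ⨆ t, (U t + ∑ j, ((σ j : ℤ) : ℝ) * h j t)
      ≤ 𝔼 τ : Fin n → Fin K → ℤˣ, ⨆ t,
        (U t + 2 * Λ * ∑ j, ∑ k, ((τ j k : ℤ) : ℝ) * v j t k) := by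
  induction n generalizing U with
  | zero => simp
  | succ n ih =>
    -- The first point is exchanged with all others already in vector form and absorbed in `U`; the
    -- induction is run with the first sign `s` frozen and `s * h 0` absorbed in `U` instead.
    have hstep (τ : Fin n → Fin K → ℤˣ) := expect_iSup_add_sign_mul_le hΛ
      (fun t => U t + 2 * Λ * ∑ j, ∑ k, ((τ j k : ℤ) : ℝ) * v j.succ t k) (h 0) (v 0) (hL 0)
      fun ε => by
        have := hb (Fin.cons ε τ)
        simp only [Fin.sum_univ_succ, Fin.cons_zero, Fin.cons_succ] at this
        convert this using 3
        ring
    conv_lhs => rw [expect_fin_cons]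
    conv_rhs => rw [expect_fin_cons, Finset.expect_comm]
    calc _ ≤ 𝔼 s : ℤˣ, 𝔼 τ : Fin n → Fin K → ℤˣ, ⨆ t,
          ((U t + 2 * Λ * ∑ j, ∑ k, ((τ j k : ℤ) : ℝ) * v j.succ t k)
            + ((s : ℤ) : ℝ) * h 0 t) := by
          refine Finset.expect_le_expect fun s _ => ?_
          have := ih (fun t => U t + ((s : ℤ) : ℝ) * h 0 t) (fun j => h j.succ)
            (fun j => v j.succ) (fun j => hL j.succ) fun τ => by
              convert (hstep τ).1 s using 3
              ring
          refine (le_of_eq ?_).trans (this.trans_eq ?_)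
          · refine Finset.expect_congr rfl fun σ _ => ?_
            congr 1 with t
            simp only [Fin.sum_univ_succ, Fin.cons_zero, Fin.cons_succ]
            ring
          · refine Finset.expect_congr rfl fun τ _ => ?_
            congr 1 with t
            ring
      _ ≤ _ := by
          rw [Finset.expect_comm]
          refine Finset.expect_le_expect fun τ _ => (hstep τ).2.trans_eq ?_
          refine Finset.expect_congr rfl fun ε _ => ?_
          congr 1 with t
          simp only [Fin.sum_univ_succ, Fin.cons_zero, Fin.cons_succ]
          ring

end Contraction

end MCUL

namespace MCUL

/-! ### Rademacher complexity of the product class. -/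

section RademacherComplexity

open scoped BigOperators

theorem ereal_coe_finsetSum {α : Type*} (s : Finset α) (r : α → ℝ) :
    ((∑ a ∈ s, r a : ℝ) : EReal) = ∑ a ∈ s, (r a : EReal) := by
  classical
  induction s using Finset.induction_on with
  | empty => simp
  | insert a s ha ih => rw [Finset.sum_insert ha, Finset.sum_insert ha, EReal.coe_add, ih]

/-- In `EReal` one has `⊤ + ⊥ = ⊥`, so an infinite summand survives only when no summand is `⊥`.
Thus a finite empirical complexity forces the supremum for every sign vector to be finite. -/
theorem ereal_sum_eq_top {α : Type*} {s : Finset α} {u : α → EReal} (hbot : ∀ a ∈ s, u a ≠ ⊥)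
    {a : α} (ha : a ∈ s) (htop : u a = ⊤) : ∑ a ∈ s, u a = ⊤ := by
  classical
  rw [← Finset.add_sum_erase s u ha, htop]
  refine EReal.top_add_of_ne_bot fun h => ?_
  have h0 : ∀ t : Finset α, (∀ b ∈ t, u b ≠ ⊥) → ∑ b ∈ t, u b ≠ ⊥ := by
    intro t
    induction t using Finset.induction_on with
    | empty => simp
    | insert c t hc ih =>
      intro ht
      rw [Finset.sum_insert hc, Ne, EReal.add_eq_bot_iff, not_or]
      exact ⟨ht c (Finset.mem_insert_self c t), ih fun b hb => ht b (Finset.mem_insert_of_mem hb)⟩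
  exact h0 _ (fun b hb => hbot b (Finset.mem_of_mem_erase hb)) h

variable {X : Type*}

theorem empiricalRademacher_mono {G G' : Set (X → ℝ)} (h : G ⊆ G') {n : ℕ} (x : Fin n → X) :
    empiricalRademacher G x ≤ empiricalRademacher G' x := by
  refine EReal.div_le_div_right_of_nonneg (by exact_mod_cast pow_nonneg zero_le_two n)
    (Finset.sum_le_sum fun σ _ => biSup_mono fun g hg => h hg)

theorem rademacher_mono [MeasurableSpace X] (μ : Measure X) {G G' : Set (X → ℝ)} (h : G ⊆ G')
    (n : ℕ) : rademacher μ G n ≤ rademacher μ G' n :=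
  lintegral_mono fun x => EReal.toENNReal_le_toENNReal (empiricalRademacher_mono h x)

theorem measurable_toENNReal_empiricalRademacher [MeasurableSpace X] {G : Set (X → ℝ)}
    (hG : G.Countable) (hm : ∀ g ∈ G, Measurable g) (n : ℕ) :
    Measurable fun x : Fin n → X => (empiricalRademacher G x).toENNReal := by
  have hpos : (0 : EReal) ≤ (((2 : ℝ) ^ n : ℝ) : EReal)⁻¹ :=
    EReal.inv_nonneg_of_nonneg (by exact_mod_cast pow_nonneg zero_le_two n)
  simp only [empiricalRademacher, EReal.div_eq_inv_mul, EReal.toENNReal_mul hpos]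
  refine Measurable.const_mul (Measurable.ereal_toENNReal ?_) _
  refine Finset.measurable_sum _ fun σ _ => Measurable.biSup G hG fun g hg => ?_
  have := hm g hg
  exact measurable_coe_real_ereal.comp (by fun_prop)

/-- Where the empirical Rademacher complexity is finite, it dominates the real-valued Rademacher
average, and all the suprema involved are finite. -/
theorem expect_iSup_le_of_empiricalRademacher_ne_top {G : Set (X → ℝ)} (hG : G.Nonempty) {n : ℕ}
    (hn : 1 ≤ n) {x : Fin n → X} (hx : empiricalRademacher G x ≠ ⊤) :
    (∀ σ : Fin n → ℤˣ, BddAbove (Set.range fun s : G => ∑ j, ((σ j : ℤ) : ℝ) * s.1 (x j))) ∧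
    𝔼 σ : Fin n → ℤˣ, ⨆ s : G, ∑ j, ((σ j : ℤ) : ℝ) * s.1 (x j)
      ≤ n * (empiricalRademacher G x).toENNReal.toReal := by
  have hn' : (0 : ℝ) < n := by exact_mod_cast hn
  have : Nonempty G := hG.to_subtype
  set T : (Fin n → ℤˣ) → EReal := fun σ =>
    ⨆ g ∈ G, ((1 / (n : ℝ) * ∑ i : Fin n, ((σ i : ℤ) : ℝ) * g (x i) : ℝ) : EReal) with hT
  have hle (σ) (s : G) :
      ((1 / (n : ℝ) * ∑ i : Fin n, ((σ i : ℤ) : ℝ) * s.1 (x i) : ℝ) : EReal) ≤ T σ :=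
    le_iSup₂ (f := fun (g : X → ℝ) (_ : g ∈ G) =>
      ((1 / (n : ℝ) * ∑ i : Fin n, ((σ i : ℤ) : ℝ) * g (x i) : ℝ) : EReal)) s.1 s.2
  have hbot (σ) : T σ ≠ ⊥ := by
    obtain ⟨s⟩ := ‹Nonempty G›
    exact ((EReal.bot_lt_coe _).trans_le (hle σ s)).ne'
  have h2 : (0 : ℝ) < 2 ^ n := by positivity
  have htop (σ) : T σ ≠ ⊤ := fun h => hx <| by
    rw [empiricalRademacher, ereal_sum_eq_top (fun σ _ => hbot σ) (Finset.mem_univ σ) h]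
    exact EReal.top_div_of_pos_ne_top (by exact_mod_cast h2) (EReal.coe_ne_top _)
  have hreal (σ) (s : G) : ∑ i : Fin n, ((σ i : ℤ) : ℝ) * s.1 (x i) ≤ n * (T σ).toReal := by
    have h1 := hle σ s
    rw [← EReal.coe_toReal (htop σ) (hbot σ), EReal.coe_le_coe_iff, one_div,
      inv_mul_le_iff₀ hn'] at h1
    exact h1
  refine ⟨fun σ => ⟨n * (T σ).toReal, by rintro _ ⟨s, rfl⟩; exact hreal σ s⟩, ?_⟩
  have hval : empiricalRademacher G x = ((𝔼 σ, (T σ).toReal : ℝ) : EReal) := by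
    rw [Fintype.expect_eq_sum_div_card, EReal.coe_div, ereal_coe_finsetSum, empiricalRademacher]
    congr 1
    · exact Finset.sum_congr rfl fun σ _ => (EReal.coe_toReal (htop σ) (hbot σ)).symm
    · simp
  rw [hval, EReal.real_coe_toENNReal, ENNReal.toReal_ofReal']
  -- Passing through `toENNReal` truncates at zero, which can only increase the average, so its sign
  -- is not needed.
  refine le_trans ?_ (mul_le_mul_of_nonneg_left (le_max_left _ _) hn'.le)
  rw [Finset.mul_expect]
  exact Finset.expect_le_expect fun σ _ => ciSup_le (hreal σ)

theorem expect_comp_eval {α κ : Type*} [Fintype α] [Nonempty α] [Fintype κ] [DecidableEq κ]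
    (F : α → ℝ) (k : κ) : 𝔼 τ : κ → α, F (τ k) = 𝔼 a, F a := by
  rw [Fintype.expect_equiv (Equiv.funSplitAt k α) (fun τ => F (τ k)) (fun p => F p.1)
    fun _ => rfl, ← Finset.univ_product_univ,
    Finset.expect_product' Finset.univ Finset.univ fun a _ => F a]
  simp only [Fintype.expect_const]

/-- The Rademacher average of a class of Lipschitz images of a product class. -/
theorem expect_iSup_lipschitz_productClass_le {K : ℕ} {Λ : ℝ} (hΛ : 0 ≤ Λ) {G : Set (X → ℝ)}
    (hG : G.Nonempty) {n : ℕ} (hn : 1 ≤ n) {x : Fin n → X} (hx : empiricalRademacher G x ≠ ⊤)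
    (h : Fin n → (Fin K → G) → ℝ)
    (hL : ∀ j t t', |h j t - h j t'|
      ≤ Λ * ‖WithLp.toLp 2 (fun k => (t k).1 (x j)) - WithLp.toLp 2 (fun k => (t' k).1 (x j))‖) :
    𝔼 σ : Fin n → ℤˣ, ⨆ t, ∑ j, ((σ j : ℤ) : ℝ) * h j t
      ≤ 2 * Λ * K * (n * (empiricalRademacher G x).toENNReal.toReal) := by
  have : Nonempty G := hG.to_subtype
  obtain ⟨hb, hE⟩ := expect_iSup_le_of_empiricalRademacher_ne_top hG hn hx
  set r : (Fin n → ℤˣ) → ℝ := fun σ => ⨆ s : G, ∑ j, ((σ j : ℤ) : ℝ) * s.1 (x j) with hr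
  -- The coordinates of a member of the product class vary independently, so the double sum is
  -- bounded by one supremum over `G` for each column of signs; every column is uniform on sign
  -- vectors, whence the factor `K`.
  have hpt (τ : Fin n → Fin K → ℤˣ) (t : Fin K → G) :
      2 * Λ * ∑ j, ∑ k, ((τ j k : ℤ) : ℝ) * (t k).1 (x j)
        ≤ 2 * Λ * ∑ k, r (fun j => τ j k) := by
    rw [Finset.sum_comm]
    gcongr with k
    exact le_ciSup (hb fun j => τ j k) (t k)
  have hc := expect_iSup_le_of_lipschitz hΛ (fun _ : Fin K → G => 0) h
    (fun j t => WithLp.toLp 2 (fun k => (t k).1 (x j))) hL fun τ =>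
      ⟨2 * Λ * ∑ k, r (fun j => τ j k), by
        rintro _ ⟨t, rfl⟩
        simpa only [zero_add] using hpt τ t⟩
  simp only [zero_add] at hc
  refine hc.trans ?_
  calc _ ≤ 𝔼 τ : Fin n → Fin K → ℤˣ, 2 * Λ * ∑ k, r (fun j => τ j k) :=
        Finset.expect_le_expect fun τ _ => ciSup_le (hpt τ)
    _ = 2 * Λ * ∑ _k : Fin K, 𝔼 σ, r σ := by
        rw [← Finset.mul_expect, Finset.expect_sum_comm]
        congr 1
        refine Finset.sum_congr rfl fun k _ => ?_
        rw [Fintype.expect_equiv (Equiv.piComm fun (_ : Fin n) (_ : Fin K) => ℤˣ)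
          (fun τ => r fun j => τ j k) (fun τ => r (τ k)) fun _ => rfl]
        exact expect_comp_eval r k
    _ = 2 * Λ * K * 𝔼 σ, r σ := by simp [mul_assoc]
    _ ≤ _ := by gcongr

/-- The expected Rademacher average of a class of Lipschitz images of a product class. -/
theorem integral_expect_iSup_lipschitz_productClass_le [MeasurableSpace X] {Z : Type*}
    [MeasurableSpace Z] {μ : Measure X} [IsProbabilityMeasure μ] {ν : Measure Z}
    [IsProbabilityMeasure ν] {φ : Z → X} (hφ : MeasurePreserving φ ν μ) {K : ℕ} {Λ B : ℝ}
    (hΛ : 0 ≤ Λ) {G : Set (X → ℝ)} (hG : G.Nonempty) (hGc : G.Countable)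
    (hGm : ∀ g ∈ G, Measurable g) {n : ℕ} (hn : 1 ≤ n) (hfin : rademacher μ G n ≠ ⊤)
    (f : (Fin K → G) → Z → ℝ) (hf : ∀ t, Measurable (f t)) (hB : ∀ t z, |f t z| ≤ B)
    (hL : ∀ z t t', |f t z - f t' z| ≤ Λ * ‖WithLp.toLp 2 (fun k => (t k).1 (φ z))
      - WithLp.toLp 2 (fun k => (t' k).1 (φ z))‖) :
    ∫ z, 𝔼 σ : Fin n → ℤˣ, ⨆ t, ∑ j, ((σ j : ℤ) : ℝ) * f t (z j)
        ∂(Measure.pi fun _ : Fin n => ν)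
      ≤ 2 * Λ * K * (n * (rademacher μ G n).toReal) := by
  have : Nonempty G := hG.to_subtype
  have : Countable G := hGc.to_subtype
  set Q : (Fin n → X) → ℝ≥0∞ := fun x => (empiricalRademacher G x).toENNReal with hQ
  have hQm : Measurable Q := measurable_toENNReal_empiricalRademacher hGc hGm n
  have hmp : MeasurePreserving (fun (z : Fin n → Z) j => φ (z j))
      (Measure.pi fun _ => ν) (Measure.pi fun _ => μ) :=
    measurePreserving_pi (fun _ => ν) (fun _ => μ) fun _ => hφ
  have hQφ : ∫⁻ z, Q (fun j => φ (z j)) ∂(Measure.pi fun _ : Fin n => ν) = rademacher μ G n :=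
    hmp.lintegral_comp hQm
  have hQφm : Measurable fun z : Fin n → Z => Q fun j => φ (z j) := hQm.comp hmp.measurable
  have hae : ∀ᵐ z ∂(Measure.pi fun _ : Fin n => ν), Q (fun j => φ (z j)) < ∞ :=
    ae_lt_top hQφm (hQφ ▸ hfin)
  have hint : Integrable (fun z : Fin n → Z => (Q fun j => φ (z j)).toReal)
      (Measure.pi fun _ : Fin n => ν) :=
    integrable_toReal_of_lintegral_ne_top hQφm.aemeasurable (hQφ ▸ hfin)
  calc _ ≤ ∫ z, 2 * Λ * K * (n * (Q fun j => φ (z j)).toReal)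
        ∂(Measure.pi fun _ : Fin n => ν) := by
        refine integral_mono_ae ?_ ((hint.const_mul _).const_mul _) ?_
        · refine Integrable.of_bound (C := n * B) ?_ (ae_of_all _ fun z => ?_)
          · refine Measurable.aestronglyMeasurable ?_
            simp only [Fintype.expect_eq_sum_div_card]
            exact (Finset.measurable_sum _ fun σ _ => Measurable.iSup fun t =>
              by fun_prop).div_const _
          · refine (Finset.abs_expect_le _ _).trans (Finset.expect_le (by simp) fun σ _ => ?_)
            refine abs_ciSup_le fun t => (Finset.abs_sum_le_sum_abs _ _).trans
              ((Finset.sum_le_sum (g := fun _ => B) fun j _ => ?_).trans (by simp))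
            rw [abs_mul, abs_sign, one_mul]
            exact hB _ _
        · filter_upwards [hae] with z hz
          refine expect_iSup_lipschitz_productClass_le hΛ hG hn
            (EReal.toENNReal_ne_top_iff.1 hz.ne) (fun j t => f t (z j)) fun j => hL (z j)
    _ = 2 * Λ * K * (n * (rademacher μ G n).toReal) := by
        rw [integral_const_mul, integral_const_mul, integral_toReal hQφm.aemeasurable hae, hQφ]

end RademacherComplexity

end MCUL

namespace MCUL

/-! ### High-probability deviation bounds for one sample. -/

section UniformDeviation

open scoped BigOperators

variable {Z : Type*} [MeasurableSpace Z] {ν : Measure Z} [IsProbabilityMeasure ν]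

/-- One-sided uniform deviations of a countable class of bounded functions concentrate around
their mean. -/
theorem exists_uniform_deviation_le_integral_add {ι : Type*} [Countable ι] [Nonempty ι] {n : ℕ}
    (hn : 1 ≤ n) {a W q : ℝ} (hW : 0 < W) (hq : 0 ≤ q) (f : ι → Z → ℝ)
    (hf : ∀ t, Measurable (f t)) (hfa : ∀ t z, f t z ∈ Set.Icc a (a + W)) :
    ∃ N : Set (Fin n → Z), MeasurableSet N ∧
      (Measure.pi fun _ : Fin n => ν) N ≤ ENNReal.ofReal (Real.exp (-q)) ∧
      ∀ x ∉ N, ∀ t, ∫ z, f t z ∂ν - (∑ j, f t (x j)) / n ≤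
        (∫ x, ⨆ t, ∑ j, ((∫ z, f t z ∂ν) - f t (x j)) ∂(Measure.pi fun _ : Fin n => ν)) / n
          + W * √(q / (2 * n)) := by
  have hn' : (0 : ℝ) < n := by exact_mod_cast hn
  have hint (t) : ∫ z, f t z ∂ν ∈ Set.Icc a (a + W) := by
    have hi : Integrable (f t) ν := Integrable.of_bound (C := max |a| |a + W|)
      (hf t).aestronglyMeasurable
      (ae_of_all _ fun z => abs_le_max_abs_abs (hfa t z).1 (hfa t z).2)
    constructor
    · simpa using integral_mono (μ := ν) (integrable_const a) hi fun z => (hfa t z).1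
    · simpa using integral_mono (μ := ν) hi (integrable_const (a + W)) fun z => (hfa t z).2
  have hterm (t z) : |(∫ z, f t z ∂ν) - f t z| ≤ W :=
    abs_le.2 ⟨by linarith [(hint t).1, (hfa t z).2], by linarith [(hint t).2, (hfa t z).1]⟩
  have hsum (t) (x : Fin n → Z) : |∑ j, ((∫ z, f t z ∂ν) - f t (x j))| ≤ n * W :=
    (Finset.abs_sum_le_sum_abs _ _).trans
      ((Finset.sum_le_sum fun j _ => hterm t (x j)).trans (by simp))
  set Φ : (Fin n → Z) → ℝ := fun x => ⨆ t, ∑ j, ((∫ z, f t z ∂ν) - f t (x j)) with hΦ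
  have hΦm : Measurable Φ := Measurable.iSup fun t => by fun_prop
  have hle (x) (t) : ∑ j, ((∫ z, f t z ∂ν) - f t (x j)) ≤ Φ x :=
    le_ciSup (f := fun t => ∑ j, ((∫ z, f t z ∂ν) - f t (x j)))
      (bddAbove_range_of_abs_le fun t => hsum t x) t
  -- Replacing one sample point changes a single summand by a difference of two values of `f t`, at
  -- most the length `W` of the range.
  have hmcd := measureReal_ge_le_of_bounded_differences ν hn hW hq (fun x => Φ x / n)
    (hΦm.div_const _) ⟨W, fun x => by
      rw [abs_div, abs_of_pos hn', div_le_iff₀ hn', mul_comm]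
      exact abs_ciSup_le fun t => hsum t x⟩ fun x i y => by
      rw [← add_div]
      gcongr
      refine ciSup_le fun t => ?_
      have h1 : ∑ j, ((∫ z, f t z ∂ν) - f t (Function.update x i y j))
          = ∑ j, ((∫ z, f t z ∂ν) - f t (x j)) + (f t (x i) - f t y) := by
        rw [← sub_eq_iff_eq_add', ← Finset.sum_sub_distrib, Finset.sum_eq_single i]
        · simp
        · intro j _ hj; simp [hj]
        · simp
      rw [h1]
      linarith [hle x t, (hfa t (x i)).2, (hfa t y).1]
  rw [integral_div] at hmcd
  refine ⟨{x | W * √(q / (2 * n)) ≤ Φ x / n - (∫ x, Φ x ∂(Measure.pi fun _ : Fin n => ν)) / n},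
    measurableSet_le measurable_const ((hΦm.div_const _).sub_const _), ?_, ?_⟩
  · rw [measureReal_def] at hmcd
    exact (ENNReal.le_ofReal_iff_toReal_le (measure_ne_top _ _) (Real.exp_pos _).le).2 hmcd
  · intro x hx t
    have h2 := not_le.1 (Set.notMem_ofPred_iff.1 hx)
    have h3 : ∫ z, f t z ∂ν - (∑ j, f t (x j)) / n ≤ Φ x / n := by
      rw [le_div_iff₀ hn', sub_mul, div_mul_cancel₀ _ hn'.ne']
      refine le_trans (le_of_eq ?_) (hle x t)
      simp [mul_comm]
    linarith

/-- **Hoeffding's inequality** for the upper deviation of an empirical mean. -/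
theorem exists_empirical_mean_le {n : ℕ} (hn : 1 ≤ n) {a W q : ℝ} (hW : 0 < W) (hq : 0 ≤ q)
    (f : Z → ℝ) (hf : Measurable f) (hfa : ∀ z, f z ∈ Set.Icc a (a + W)) :
    ∃ N : Set (Fin n → Z), MeasurableSet N ∧
      (Measure.pi fun _ : Fin n => ν) N ≤ ENNReal.ofReal (Real.exp (-q)) ∧
      ∀ x ∉ N, (∑ j, f (x j)) / n - ∫ z, f z ∂ν ≤ W * √(q / (2 * n)) := by
  -- A one-member class consisting of `-f`: the supremum is trivial, so its expectation is that of a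
  -- centred sum and vanishes.
  obtain ⟨N, hN, hNq, h⟩ := exists_uniform_deviation_le_integral_add (ν := ν) (n := n) hn
    (a := -(a + W)) hW hq (fun (_ : Unit) z => - f z) (fun _ => hf.neg)
    fun _ z => ⟨by linarith [(hfa z).2], by linarith [(hfa z).1]⟩
  refine ⟨N, hN, hNq, fun x hx => ?_⟩
  have hi : Integrable f ν := Integrable.of_bound (C := max |a| |a + W|)
    hf.aestronglyMeasurable (ae_of_all _ fun z => abs_le_max_abs_abs (hfa z).1 (hfa z).2)
  have hev (j : Fin n) : ∫ x : Fin n → Z, f (x j) ∂(Measure.pi fun _ => ν) = ∫ z, f z ∂ν :=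
    integral_comp_eval (μ := fun _ : Fin n => ν) hf.aestronglyMeasurable
  have hevi (j : Fin n) : Integrable (fun x : Fin n → Z => f (x j)) (Measure.pi fun _ => ν) :=
    Integrable.of_bound (C := max |a| |a + W|)
      (by fun_prop : Measurable fun x : Fin n → Z => f (x j)).aestronglyMeasurable
      (ae_of_all _ fun x => abs_le_max_abs_abs (hfa _).1 (hfa _).2)
  have hd (j : Fin n) : Integrable (fun x : Fin n → Z => (∫ z, - f z ∂ν) - - f (x j))
      (Measure.pi fun _ => ν) := (integrable_const _).sub (hevi j).neg
  have h0 : ∫ x : Fin n → Z, ⨆ _ : Unit, ∑ j, ((∫ z, - f z ∂ν) - - f (x j))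
      ∂(Measure.pi fun _ => ν) = 0 := by
    simp only [ciSup_unique]
    rw [integral_finsetSum _ fun j _ => hd j]
    refine Finset.sum_eq_zero fun j _ => ?_
    simp only [sub_neg_eq_add]
    rw [integral_add (integrable_const _) (hevi j), integral_neg, hev]
    simp
  have h1 := h x hx ()
  rw [h0, integral_neg, Finset.sum_neg_distrib, zero_div, zero_add, neg_div] at h1
  linarith

variable {X : Type*} [MeasurableSpace X] {K : ℕ}

theorem measurable_of_mem_productClass {G : Set (X → ℝ)} (hG : ∀ g ∈ G, Measurable g)
    {g : X → EuclideanSpace ℝ (Fin K)} (hg : g ∈ productClass K G) : Measurable g :=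
  (WithLp.measurable_toLp 2 (Fin K → ℝ)).comp (measurable_pi_iff.2 fun k => hG _ (hg k))

/-- **Uniform deviation bound** for the Lipschitz images `z ↦ H z (g (φ z))` of a product class,
together with Hoeffding's bound for one of its members. -/
theorem exists_productClass_deviation_le [Nonempty (Fin K)] {μ : Measure X} [IsProbabilityMeasure μ]
    {φ : Z → X} (hφ : MeasurePreserving φ ν μ) {G : Set (X → ℝ)} (hG : PointwiseMeasurable G)
    {n : ℕ} (hn : 1 ≤ n) (hfin : rademacher μ G n ≠ ⊤) {Λ a W q : ℝ} (hΛ : 0 ≤ Λ) (hW : 0 < W)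
    (hq : 0 ≤ q) (H : Z → EuclideanSpace ℝ (Fin K) → ℝ)
    (hHm : Measurable (Function.uncurry H))
    (hHL : ∀ z w w', |H z w - H z w'| ≤ Λ * ‖w - w'‖)
    (hHa : ∀ g ∈ productClass K G, ∀ z, H z (g (φ z)) ∈ Set.Icc a (a + W))
    {g₀ : X → EuclideanSpace ℝ (Fin K)} (hg₀ : g₀ ∈ productClass K G)
    {Ω : Type*} [MeasurableSpace Ω] {P : Measure Ω} [IsProbabilityMeasure P]
    {ξ : Fin n → Ω → Z} (hind : iIndepFun ξ P) (hlaw : ∀ j, HasLaw (ξ j) ν P) :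
    ∃ N : Set Ω, P N ≤ ENNReal.ofReal (2 * Real.exp (-q)) ∧ ∀ ω ∉ N,
      (∀ g ∈ productClass K G,
        ∫ z, H z (g (φ z)) ∂ν - (∑ j, H (ξ j ω) (g (φ (ξ j ω)))) / n
          ≤ 4 * Λ * K * (rademacher μ G n).toReal + W * √(q / (2 * n))) ∧
      (∑ j, H (ξ j ω) (g₀ (φ (ξ j ω)))) / n - ∫ z, H z (g₀ (φ z)) ∂ν ≤ W * √(q / (2 * n)) := by
  have hn' : (0 : ℝ) < n := by exact_mod_cast hn
  obtain ⟨hGm, G₀, hG₀, hG₀c, happrox⟩ := hG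
  obtain ⟨k₀⟩ := ‹Nonempty (Fin K)›
  have hG₀n : G₀.Nonempty := by
    obtain ⟨u, hu, -⟩ := happrox _ (hg₀ k₀)
    exact ⟨u 0, hu 0⟩
  have : Nonempty G₀ := hG₀n.to_subtype
  have : Countable G₀ := hG₀c.to_subtype
  have hGm₀ : ∀ g ∈ G₀, Measurable g := fun g hg => hGm g (hG₀ hg)
  have hHg {g : X → EuclideanSpace ℝ (Fin K)} (hg : g ∈ productClass K G) :
      Measurable fun z => H z (g (φ z)) :=
    hHm.comp (measurable_id.prodMk
      ((measurable_of_mem_productClass hGm hg).comp hφ.measurable))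
  set dec : (Fin K → G₀) → X → EuclideanSpace ℝ (Fin K) :=
    fun t x => WithLp.toLp 2 fun k => (t k).1 x with hdec
  have hdecG (t) : dec t ∈ productClass K G := fun k => hG₀ (t k).2
  have hfin₀ : rademacher μ G₀ n ≠ ⊤ := ne_top_of_le_ne_top hfin (rademacher_mono μ hG₀ n)
  have hbd {g : X → EuclideanSpace ℝ (Fin K)} (hg : g ∈ productClass K G) (z : Z) :
      |H z (g (φ z))| ≤ max |a| |a + W| :=
    abs_le_max_abs_abs (hHa g hg z).1 (hHa g hg z).2
  obtain ⟨N₁, hN₁, hN₁q, h₁⟩ := exists_uniform_deviation_le_integral_add (ν := ν) (n := n) hn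
    hW hq (fun t z => H z (dec t (φ z))) (fun t => hHg (hdecG t)) fun t z => hHa _ (hdecG t) z
  obtain ⟨N₂, hN₂, hN₂q, h₂⟩ := exists_empirical_mean_le (ν := ν) (n := n) hn hW hq
    (fun z => H z (g₀ (φ z))) (hHg hg₀) fun z => hHa _ hg₀ z
  have hsym := integral_iSup_deviation_le (n := n) ν (fun t z => H z (dec t (φ z)))
    (fun t => hHg (hdecG t)) fun t z => hbd (hdecG t) z
  have hrad := integral_expect_iSup_lipschitz_productClass_le hφ hΛ hG₀n hG₀c hGm₀ hn hfin₀
    (fun t z => H z (dec t (φ z))) (fun t => hHg (hdecG t)) (fun t z => hbd (hdecG t) z)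
    fun z t t' => hHL z _ _
  have hmean : (∫ x, ⨆ t, ∑ j, ((∫ z, H z (dec t (φ z)) ∂ν) - H (x j) (dec t (φ (x j))))
      ∂(Measure.pi fun _ : Fin n => ν)) / n ≤ 4 * Λ * K * (rademacher μ G n).toReal := by
    rw [div_le_iff₀ hn']
    have hmono : (rademacher μ G₀ n).toReal ≤ (rademacher μ G n).toReal :=
      ENNReal.toReal_mono hfin (rademacher_mono μ hG₀ n)
    calc _ ≤ 2 * (2 * Λ * K * (n * (rademacher μ G₀ n).toReal)) :=
          hsym.trans (mul_le_mul_of_nonneg_left hrad zero_le_two)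
      _ ≤ 2 * (2 * Λ * K * (n * (rademacher μ G n).toReal)) := by gcongr
      _ = _ := by ring
  have hmap : P.map (fun ω j => ξ j ω) = Measure.pi fun _ : Fin n => ν := by
    rw [(iIndepFun_iff_map_fun_eq_pi_map fun j => (hlaw j).aemeasurable).1 hind]
    simp only [(hlaw _).map_eq]
  have hξ : AEMeasurable (fun ω j => ξ j ω) P := aemeasurable_pi_lambda _ fun j =>
    (hlaw j).aemeasurable
  refine ⟨(fun ω j => ξ j ω) ⁻¹' (N₁ ∪ N₂), ?_, fun ω hω => ?_⟩
  · rw [← Measure.map_apply_of_aemeasurable hξ (hN₁.union hN₂), hmap, two_mul,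
      ENNReal.ofReal_add (Real.exp_pos _).le (Real.exp_pos _).le]
    exact (measure_union_le _ _).trans (add_le_add hN₁q hN₂q)
  · rw [Set.mem_preimage, Set.mem_union, not_or] at hω
    refine ⟨fun g hg => ?_, h₂ _ hω.2⟩
    -- Coordinatewise approximation from the countable subclass. The exceptional set does not depend
    -- on `g`, so both the mean and the empirical mean can pass to the limit outside it.
    choose u hu hlim using fun k => happrox _ (hg k)
    set t : ℕ → Fin K → G₀ := fun m k => ⟨u k m, hu k m⟩ with ht
    have hconv (z : Z) : Tendsto (fun m => H z (dec (t m) (φ z))) atTop (𝓝 (H z (g (φ z)))) := by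
      have hc : Continuous (H z) := (LipschitzWith.of_dist_le_mul (K := ⟨Λ, hΛ⟩) fun w w' => by
        rw [Real.dist_eq, dist_eq_norm]; exact hHL z w w').continuous
      refine (hc.tendsto _).comp ?_
      have : Tendsto (fun m k => (t m k).1 (φ z)) atTop (𝓝 fun k => g (φ z) k) :=
        tendsto_pi_nhds.2 fun k => hlim k (φ z)
      exact ((PiLp.continuous_toLp 2 fun _ : Fin K => ℝ).tendsto _).comp this
    have hI : Tendsto (fun m => ∫ z, H z (dec (t m) (φ z)) ∂ν) atTop
        (𝓝 (∫ z, H z (g (φ z)) ∂ν)) :=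
      tendsto_integral_of_dominated_convergence (fun _ => max |a| |a + W|)
        (fun m => (hHg (hdecG _)).aestronglyMeasurable) (integrable_const _)
        (fun m => ae_of_all _ fun z => hbd (hdecG _) z) (ae_of_all _ hconv)
    have hS : Tendsto (fun m => (∑ j, H (ξ j ω) (dec (t m) (φ (ξ j ω)))) / n) atTop
        (𝓝 ((∑ j, H (ξ j ω) (g (φ (ξ j ω)))) / n)) :=
      (tendsto_finsetSum _ fun j _ => hconv (ξ j ω)).div_const _
    refine le_of_tendsto (hI.sub hS) (Eventually.of_forall fun m => ?_)
    exact (h₁ _ hω.1 (t m)).trans (by gcongr)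

end UniformDeviation

end MCUL

namespace MCUL

/-! ### Marginals and expectations under the complementary-label law. -/

section ComplementaryLaw

variable {X : Type*} [MeasurableSpace X] {K : ℕ} (D : Measure (X × Fin K))

theorem classMeasure_apply {y : Fin K} {s : Set X} (hs : MeasurableSet s) :
    classMeasure D y s = D.restrict (Prod.fst ⁻¹' s) (Prod.snd ⁻¹' {y}) := by
  rw [classMeasure, Measure.map_apply measurable_fst hs,
    Measure.restrict_apply (measurable_fst hs),
    Measure.restrict_apply (measurable_snd (measurableSet_singleton y)), Set.inter_comm]

theorem marginal_eq_sum_classMeasure : marginal D = ∑ y, classMeasure D y := by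
  ext s hs
  rw [marginal, Measure.map_apply measurable_fst hs, Measure.finsetSum_apply]
  simp only [classMeasure_apply D hs]
  rw [sum_measure_preimage_singleton _ fun y _ => measurable_snd (measurableSet_singleton y)]
  simp

theorem eq_sum_restrict_snd : D = ∑ y, D.restrict (Prod.snd ⁻¹' {y}) := by
  ext s hs
  rw [Measure.finsetSum_apply]
  have (y : Fin K) : D.restrict (Prod.snd ⁻¹' {y}) s = D.restrict s (Prod.snd ⁻¹' {y}) := by
    rw [Measure.restrict_apply hs,
      Measure.restrict_apply (measurable_snd (measurableSet_singleton y)), Set.inter_comm]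
  simp only [this]
  rw [sum_measure_preimage_singleton _ fun y _ => measurable_snd (measurableSet_singleton y)]
  simp

instance [IsFiniteMeasure D] (y : Fin K) : IsFiniteMeasure (classMeasure D y) := by
  unfold classMeasure; infer_instance

theorem filter_notMem_powersetCard {α : Type*} [DecidableEq α] (s : Finset α) (c : ℕ) (y : α) :
    (s.powersetCard c).filter (fun Y => y ∉ Y) = (s.erase y).powersetCard c := by
  ext Y
  simp only [Finset.mem_filter, Finset.mem_powersetCard, Finset.subset_erase]
  tauto

theorem card_filter_notMem (c : ℕ) (y : Fin K) :
    (((Finset.univ : Finset (Fin K)).powersetCard c).filter fun Y => y ∉ Y).card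
      = (K - 1).choose c := by
  rw [filter_notMem_powersetCard, Finset.card_powersetCard,
    Finset.card_erase_of_mem (Finset.mem_univ y), Finset.card_univ, Fintype.card_fin]

theorem sum_powersetCard_sum_compl {M : Type*} [AddCommMonoid M] (c : ℕ)
    (F : Finset (Fin K) → Fin K → M) :
    ∑ Y ∈ (Finset.univ : Finset (Fin K)).powersetCard c, ∑ y ∈ Yᶜ, F Y y
      = ∑ y, ∑ Y ∈ ((Finset.univ : Finset (Fin K)).powersetCard c).filter fun Y => y ∉ Y, F Y y :=
  Finset.sum_comm' fun Y y => by simp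

/-- Each class `y` contributes once for every `c`-set avoiding `y`; there are `(K - 1).choose c` of
these, cancelling the normalization. -/
theorem measurePreserving_fst_compLaw {c : ℕ} (hc : c ≤ K - 1) :
    MeasurePreserving Prod.fst (compLaw D c) (marginal D) := by
  refine ⟨measurable_fst, ?_⟩
  have hch : ((K - 1).choose c : ℝ≥0∞) ≠ 0 := by exact_mod_cast (Nat.choose_pos hc).ne'
  ext s hs
  rw [Measure.map_apply measurable_fst hs, compLaw, Measure.finsetSum_apply,
    marginal_eq_sum_classMeasure, Measure.finsetSum_apply]
  have h (Y : Finset (Fin K)) :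
      ((((K - 1).choose c : ℝ≥0∞)⁻¹ • ∑ y ∈ Yᶜ, classMeasure D y).map fun x => (x, Y))
        (Prod.fst ⁻¹' s) = ∑ y ∈ Yᶜ, ((K - 1).choose c : ℝ≥0∞)⁻¹ * classMeasure D y s := by
    rw [Measure.map_apply (by fun_prop) (measurable_fst hs), Measure.smul_apply,
      Measure.finsetSum_apply, smul_eq_mul, Finset.mul_sum]
    rfl
  simp only [h]
  rw [sum_powersetCard_sum_compl]
  refine Finset.sum_congr rfl fun y _ => ?_
  rw [Finset.sum_const, card_filter_notMem, nsmul_eq_mul, ← mul_assoc,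
    ENNReal.mul_inv_cancel hch (ENNReal.natCast_ne_top _), one_mul]

variable [IsProbabilityMeasure D]

theorem integral_eq_sum_classMeasure {B : ℝ} (F : X × Fin K → ℝ) (hF : Measurable F)
    (hB : ∀ p, |F p| ≤ B) : ∫ p, F p ∂D = ∑ y, ∫ x, F (x, y) ∂(classMeasure D y) := by
  conv_lhs => rw [eq_sum_restrict_snd D]
  rw [integral_finsetSum_measure fun y _ => Integrable.of_bound (C := B)
    hF.aestronglyMeasurable (ae_of_all _ hB)]
  refine Finset.sum_congr rfl fun y _ => ?_
  have hFy : Measurable fun x => F (x, y) := hF.comp measurable_prodMk_right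
  rw [classMeasure, integral_map measurable_fst.aemeasurable hFy.aestronglyMeasurable]
  refine setIntegral_congr_fun (measurable_snd (measurableSet_singleton y)) fun p hp => ?_
  rw [← show p.2 = y from hp]

theorem integral_marginal_eq_sum_classMeasure {B : ℝ} (F : X → ℝ) (hF : Measurable F)
    (hB : ∀ x, |F x| ≤ B) : ∫ x, F x ∂(marginal D) = ∑ y, ∫ x, F x ∂(classMeasure D y) := by
  rw [marginal_eq_sum_classMeasure, integral_finsetSum_measure fun y _ =>
    Integrable.of_bound (C := B) hF.aestronglyMeasurable (ae_of_all _ hB)]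

theorem integral_compLaw {B : ℝ} {c : ℕ} (hc : c ≤ K - 1) (F : X × Finset (Fin K) → ℝ)
    (hF : Measurable F) (hB : ∀ p, |F p| ≤ B) :
    ∫ p, F p ∂(compLaw D c) = ((K - 1).choose c : ℝ)⁻¹ *
      ∑ Y ∈ (Finset.univ : Finset (Fin K)).powersetCard c, ∑ y ∈ Yᶜ,
        ∫ x, F (x, Y) ∂(classMeasure D y) := by
  have hch : ((K - 1).choose c : ℝ≥0∞)⁻¹ ≠ ⊤ :=
    ENNReal.inv_ne_top.2 (by exact_mod_cast (Nat.choose_pos hc).ne')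
  have hfin (Y : Finset (Fin K)) : IsFiniteMeasure
      ((((K - 1).choose c : ℝ≥0∞)⁻¹ • ∑ y ∈ Yᶜ, classMeasure D y).map fun x => (x, Y)) := by
    have := Measure.smul_finite (∑ y ∈ Yᶜ, classMeasure D y) hch
    infer_instance
  rw [compLaw, integral_finsetSum_measure fun Y _ => Integrable.of_bound (C := B)
    hF.aestronglyMeasurable (ae_of_all _ hB), Finset.mul_sum]
  refine Finset.sum_congr rfl fun Y _ => ?_
  have hFY : Measurable fun x => F (x, Y) := hF.comp measurable_prodMk_right
  rw [integral_map (by fun_prop) hF.aestronglyMeasurable, integral_smul_measure,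
    integral_finsetSum_measure fun y _ => Integrable.of_bound (C := B)
      hFY.aestronglyMeasurable (ae_of_all _ fun x => hB (x, Y))]
  simp

/-- Among the `c`-sets avoiding `y`, a fraction `c / (K - 1)` contains `y'`. Removing the sets that
avoid both leaves `(K - 2).choose (c - 1)` by Pascal's rule, and the absorption identity gives the
ratio. -/
theorem card_filter_notMem_mem {c : ℕ} (hc : 1 ≤ c) (hcK : c ≤ K - 1) {y y' : Fin K}
    (h : y ≠ y') :
    ((((Finset.univ : Finset (Fin K)).powersetCard c).filter fun Y => y ∉ Y).filter
      fun Y => y' ∈ Y).card * (K - 1) = c * (K - 1).choose c := by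
  have h1 := Finset.card_filter_add_card_filter_not (s :=
    ((Finset.univ : Finset (Fin K)).powersetCard c).filter fun Y => y ∉ Y) (fun Y => y' ∈ Y)
  rw [card_filter_notMem, filter_notMem_powersetCard, filter_notMem_powersetCard,
    Finset.card_powersetCard, Finset.card_erase_of_mem (Finset.mem_erase.2 ⟨h.symm, by simp⟩),
    Finset.card_erase_of_mem (Finset.mem_univ y), Finset.card_univ, Fintype.card_fin] at h1
  rw [filter_notMem_powersetCard]
  obtain ⟨d, rfl⟩ := Nat.exists_eq_add_of_le' hc
  obtain ⟨m, hm⟩ := Nat.exists_eq_add_of_le' (hc.trans hcK)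
  rw [hm] at h1 ⊢
  rw [Nat.add_sub_cancel, Nat.choose_succ_succ'] at h1
  have h2 := Nat.add_one_mul_choose_eq m d
  rw [Nat.add_right_cancel h1, mul_comm, h2, mul_comm]

/-- The expected cumulative loss over a complementary-label set. -/
theorem integral_compLaw_sum_mem {c : ℕ} (hc : 1 ≤ c) (hcK : c ≤ K - 1) {B : ℝ}
    (ψ : Fin K → X → ℝ) (hψ : ∀ y, Measurable (ψ y)) (hB : ∀ y x, |ψ y x| ≤ B) :
    ∫ p, ∑ y ∈ p.2, ψ y p.1 ∂(compLaw D c)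
      = c / ((K : ℝ) - 1) * (∫ x, ∑ y, ψ y x ∂(marginal D) - ∫ p, ψ p.2 p.1 ∂D) := by
  classical
  have hK : (0 : ℝ) < (K : ℝ) - 1 := by
    have : (2 : ℝ) ≤ K := by exact_mod_cast (by omega : 2 ≤ K)
    linarith
  have hch : (0 : ℝ) < (K - 1).choose c := by exact_mod_cast Nat.choose_pos hcK
  set I : Fin K → Fin K → ℝ := fun y' y => ∫ x, ψ y' x ∂(classMeasure D y) with hI
  have hint (y' y : Fin K) : Integrable (ψ y') (classMeasure D y) :=
    Integrable.of_bound (C := B) (hψ y').aestronglyMeasurable (ae_of_all _ (hB y'))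
  have hsum (s : Finset (Fin K)) (x : X) : |∑ y ∈ s, ψ y x| ≤ ∑ _y : Fin K, |B| :=
    (Finset.abs_sum_le_sum_abs _ _).trans <|
      (Finset.sum_le_sum fun y _ => (hB y x).trans (le_abs_self B)).trans <|
        Finset.sum_le_sum_of_subset_of_nonneg (Finset.subset_univ s) fun _ _ _ => abs_nonneg B
  have hmeas : Measurable fun p : X × Finset (Fin K) => ∑ y ∈ p.2, ψ y p.1 :=
    measurable_from_prod_countable_left fun Y => Finset.measurable_sum Y fun y _ => hψ y
  have hmeas' : Measurable fun p : X × Fin K => ψ p.2 p.1 :=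
    measurable_from_prod_countable_left hψ
  rw [integral_compLaw D hcK _ hmeas fun p => hsum p.2 p.1,
    integral_marginal_eq_sum_classMeasure D _ (Finset.measurable_sum _ fun y _ => hψ y)
      fun x => hsum _ x,
    integral_eq_sum_classMeasure D _ hmeas' fun p => hB p.2 p.1, sum_powersetCard_sum_compl,
    ← Finset.sum_sub_distrib, Finset.mul_sum, Finset.mul_sum]
  refine Finset.sum_congr rfl fun y _ => ?_
  simp only [integral_finsetSum _ fun y' _ => hint y' y]
  -- The indicator covers the true class `y' = y`, which is never in the set; summed over `y'`, it
  -- is what turns the cumulative loss into the cumulative loss minus the ordinary loss.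
  have hcount (y' : Fin K) : ((((Finset.univ : Finset (Fin K)).powersetCard c).filter
      fun Y => y ∉ Y).filter fun Y => y' ∈ Y).card * I y' y
        = (K - 1).choose c * (c / ((K : ℝ) - 1)) * (I y' y - if y' = y then I y y else 0) := by
    split_ifs with h
    · subst h
      simp [Finset.filter_filter]
    · have h1 := card_filter_notMem_mem hc hcK (Ne.symm h)
      have h2 := congrArg (Nat.cast (R := ℝ)) h1
      push_cast [Nat.cast_sub (by omega : 1 ≤ K)] at h2
      rw [← eq_div_iff hK.ne'] at h2
      rw [h2]
      ring
  calc _ = ((K - 1).choose c : ℝ)⁻¹ * ∑ y', ((((Finset.univ : Finset (Fin K)).powersetCard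
        c).filter fun Y => y ∉ Y).filter fun Y => y' ∈ Y).card * I y' y := by
        congr 1
        rw [Finset.sum_comm' (t' := Finset.univ) (s' := fun y' =>
          (((Finset.univ : Finset (Fin K)).powersetCard c).filter
            fun Y => y ∉ Y).filter fun Y => y' ∈ Y) (by simp)]
        simp [hI]
    _ = _ := by
        simp only [hcount]
        rw [← Finset.mul_sum, Finset.sum_sub_distrib, Finset.sum_ite_eq' Finset.univ y]
        simp only [Finset.mem_univ, if_true]
        field_simp
        rfl

end ComplementaryLaw

end MCUL

namespace MCUL

/-! ### Nonnegativity and rate of the explicit bound. -/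

section Bounds

/-- Every bracket is at most a fixed multiple of `1/√m`, and all weights are bounded by `K` because
`c ≥ 1`, `γ ≥ 0` and `α c ≤ 1`. Nonnegativity serves the degenerate case `C = 0` of the theorem. -/
theorem errorBound_nonneg_and_le {X : Type*} [MeasurableSpace X] {K : ℕ} (hK : 2 ≤ K)
    {μ : Measure X} {G : Set (X → ℝ)} {L CG : ℝ≥0} {C δ γ : ℝ} {α : ℕ → ℝ} {nu : ℕ} {n : ℕ → ℕ}
    (hC : 0 ≤ C) (hγ : 0 ≤ γ) (hγ1 : γ ≤ 1) (hα : ∀ c ∈ Finset.Icc 1 (K - 1), 0 ≤ α c)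
    (hα1 : ∑ c ∈ Finset.Icc 1 (K - 1), α c = 1)
    (hnu : 1 ≤ nu) (hn : ∀ c ∈ Finset.Icc 1 (K - 1), 1 ≤ n c)
    (hR : ∀ m : ℕ, 1 ≤ m → rademacher μ G m ≤ ENNReal.ofReal (CG / √(m : ℝ))) :
    0 ≤ errorBound K μ G L C γ α nu n δ ∧
    errorBound K μ G L C γ α nu n δ
      ≤ 2 * K * K * (2 * K * L * CG + |C| * √(Real.log (2 * K / δ) / 2))
        * (1 / √(nu : ℝ) + ∑ c ∈ Finset.Icc 1 (K - 1), 1 / √(n c : ℝ)) := by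
  have hK' : (2 : ℝ) ≤ K := by exact_mod_cast hK
  set V : ℝ := 2 * K * L * CG + |C| * √(Real.log (2 * K / δ) / 2) with hV
  have hV0 : 0 ≤ V := by positivity
  set b : ℕ → ℝ := fun m => 2 * K * L * (rademacher μ G m).toReal
        + C * √(Real.log (2 * K / δ) / (2 * m)) with hb
  have hb0 (m) : 0 ≤ b m := by positivity
  have hbV (m : ℕ) (hm : 1 ≤ m) : b m ≤ V * (1 / √(m : ℝ)) := by
    have h1 : (rademacher μ G m).toReal ≤ CG / √(m : ℝ) :=
      ENNReal.toReal_le_of_le_ofReal (by positivity) (hR m hm)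
    have h2 : √(Real.log (2 * K / δ) / (2 * m)) = √(Real.log (2 * K / δ) / 2) / √(m : ℝ) := by
      rw [← div_div, Real.sqrt_div' _ (by positivity)]
    calc b m ≤ 2 * K * L * (CG / √(m : ℝ)) + C * (√(Real.log (2 * K / δ) / 2) / √(m : ℝ)) := by
          simp only [hb]; rw [h2]; gcongr
      _ = V * (1 / √(m : ℝ)) := by rw [hV, abs_of_nonneg hC]; ring
  have hA {c : ℕ} (hc : c ∈ Finset.Icc 1 (K - 1)) :
      0 ≤ ((K : ℝ) - 1) / c + 1 - γ ∧ ((K : ℝ) - 1) / c + 1 - γ ≤ K := by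
    have hc1 : (1 : ℝ) ≤ c := by exact_mod_cast (Finset.mem_Icc.1 hc).1
    have h0 : 0 ≤ ((K : ℝ) - 1) / c := div_nonneg (by linarith) (by linarith)
    have h1 : ((K : ℝ) - 1) / c ≤ K - 1 := div_le_self (by linarith) hc1
    constructor <;> linarith
  have hα1' {c : ℕ} (hc : c ∈ Finset.Icc 1 (K - 1)) : α c ≤ 1 :=
    hα1 ▸ Finset.single_le_sum (f := α) hα hc
  have e : errorBound K μ G L C γ α nu n δ = 2 * K * (γ * b nu
    + ∑ c ∈ Finset.Icc 1 (K - 1), (((K : ℝ) - 1) / c + 1 - γ) * α c * b (n c)) := rfl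
  rw [e]
  constructor
  · refine mul_nonneg (by positivity) (add_nonneg (mul_nonneg hγ (hb0 _))
      (Finset.sum_nonneg fun c hc => mul_nonneg (mul_nonneg (hA hc).1 (hα c hc)) (hb0 _)))
  · have h1 : γ * b nu ≤ K * (V * (1 / √(nu : ℝ))) :=
      mul_le_mul (by linarith) (hbV nu hnu) (hb0 _) (by linarith)
    have h2 : ∑ c ∈ Finset.Icc 1 (K - 1), (((K : ℝ) - 1) / c + 1 - γ) * α c * b (n c)
        ≤ ∑ c ∈ Finset.Icc 1 (K - 1), K * (V * (1 / √(n c : ℝ))) := by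
      refine Finset.sum_le_sum fun c hc => mul_le_mul ?_ (hbV _ (hn c hc)) (hb0 _) (by linarith)
      calc _ ≤ (K : ℝ) * 1 := mul_le_mul (hA hc).2 (hα1' hc) (hα c hc) (by linarith)
        _ = K := mul_one _
    calc _ ≤ 2 * K * (K * (V * (1 / √(nu : ℝ)))
          + ∑ c ∈ Finset.Icc 1 (K - 1), K * (V * (1 / √(n c : ℝ)))) := by gcongr
      _ = _ := by rw [← Finset.mul_sum, ← Finset.mul_sum]; ring

end Bounds

/-! ### Lipschitz constants and ranges of the per-point losses. -/

section Losses

variable {K : ℕ} {ℓ : EuclideanSpace ℝ (Fin K) → Fin K → ℝ} {L : ℝ≥0}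

/-- The contribution of a point with complementary-label set `Y` of nominal size `c`. -/
noncomputable def complementaryLoss (ℓ : EuclideanSpace ℝ (Fin K) → Fin K → ℝ) (γ : ℝ) (c : ℕ)
    (Y : Finset (Fin K)) (w : EuclideanSpace ℝ (Fin K)) : ℝ :=
  (1 - γ) * cumulativeLoss ℓ w - ((K : ℝ) - 1) / c * ∑ y ∈ Y, ℓ w y

theorem abs_sum_sub_sum_le (hL : ∀ y, LipschitzWith L (fun z => ℓ z y)) (Y : Finset (Fin K))
    (w w' : EuclideanSpace ℝ (Fin K)) :
    |∑ y ∈ Y, ℓ w y - ∑ y ∈ Y, ℓ w' y| ≤ K * L * ‖w - w'‖ := by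
  rw [← Finset.sum_sub_distrib]
  calc _ ≤ ∑ y ∈ Y, |ℓ w y - ℓ w' y| := Finset.abs_sum_le_sum_abs _ _
    _ ≤ ∑ _y ∈ Y, (L : ℝ) * ‖w - w'‖ := Finset.sum_le_sum fun y _ => by
        have := (hL y).dist_le_mul w w'
        rwa [Real.dist_eq, dist_eq_norm] at this
    _ ≤ ∑ _y : Fin K, (L : ℝ) * ‖w - w'‖ :=
        Finset.sum_le_sum_of_subset_of_nonneg (Finset.subset_univ Y) fun _ _ _ => by positivity
    _ = _ := by simp [mul_assoc]

theorem abs_complementaryLoss_sub_le (hL : ∀ y, LipschitzWith L (fun z => ℓ z y)) {γ : ℝ}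
    (hγ : γ ≤ 1) (hK : 1 ≤ K) (c : ℕ) (Y : Finset (Fin K)) (w w' : EuclideanSpace ℝ (Fin K)) :
    |complementaryLoss ℓ γ c Y w - complementaryLoss ℓ γ c Y w'|
      ≤ K * L * (((K : ℝ) - 1) / c + 1 - γ) * ‖w - w'‖ := by
  have hK' : 0 ≤ ((K : ℝ) - 1) / c :=
    div_nonneg (sub_nonneg.2 (by exact_mod_cast hK)) (Nat.cast_nonneg c)
  have e : complementaryLoss ℓ γ c Y w - complementaryLoss ℓ γ c Y w'
      = (1 - γ) * (∑ y, ℓ w y - ∑ y, ℓ w' y)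
        - ((K : ℝ) - 1) / c * (∑ y ∈ Y, ℓ w y - ∑ y ∈ Y, ℓ w' y) := by
    simp only [complementaryLoss, cumulativeLoss]; ring
  rw [e]
  refine (abs_sub _ _).trans ?_
  rw [abs_mul, abs_mul, abs_of_nonneg (sub_nonneg.2 hγ), abs_of_nonneg hK']
  calc _ ≤ (1 - γ) * (K * L * ‖w - w'‖) + ((K : ℝ) - 1) / c * (K * L * ‖w - w'‖) :=
        add_le_add (mul_le_mul_of_nonneg_left (abs_sum_sub_sum_le hL _ _ _) (sub_nonneg.2 hγ))
          (mul_le_mul_of_nonneg_left (abs_sum_sub_sum_le hL _ _ _) hK')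
    _ = _ := by ring

theorem sum_mem_Icc {C : ℝ} {w : EuclideanSpace ℝ (Fin K)} (h0 : ∀ y, 0 ≤ ℓ w y)
    (hC : ∀ y, ℓ w y ≤ C) (Y : Finset (Fin K)) : ∑ y ∈ Y, ℓ w y ∈ Set.Icc 0 (K * C) := by
  refine ⟨Finset.sum_nonneg fun y _ => h0 y, ?_⟩
  calc _ ≤ ∑ y, ℓ w y :=
        Finset.sum_le_sum_of_subset_of_nonneg (Finset.subset_univ Y) fun y _ _ => h0 y
    _ ≤ ∑ _y : Fin K, C := Finset.sum_le_sum fun y _ => hC y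
    _ = _ := by simp

/-- The two terms have opposite signs, so the upper endpoint is `(1 - γ) K C`. Only the length of
the interval enters the deviation bounds, and it carries the same weight `(K - 1)/c + 1 - γ` as the
Lipschitz constant. -/
theorem complementaryLoss_mem_Icc {C γ : ℝ} (hγ : γ ≤ 1) (hK : 1 ≤ K) (c : ℕ)
    {w : EuclideanSpace ℝ (Fin K)} (h0 : ∀ y, 0 ≤ ℓ w y)
    (hC : ∀ y, ℓ w y ≤ C) (Y : Finset (Fin K)) :
    complementaryLoss ℓ γ c Y w ∈ Set.Icc (-(((K : ℝ) - 1) / c * (K * C)))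
      (-(((K : ℝ) - 1) / c * (K * C)) + K * C * (((K : ℝ) - 1) / c + 1 - γ)) := by
  have hK' : 0 ≤ ((K : ℝ) - 1) / c :=
    div_nonneg (sub_nonneg.2 (by exact_mod_cast hK)) (Nat.cast_nonneg c)
  have h1 := sum_mem_Icc h0 hC Finset.univ
  have h2 := sum_mem_Icc h0 hC Y
  have a1 := mul_le_mul_of_nonneg_left h1.2 (sub_nonneg.2 hγ)
  have a2 := mul_le_mul_of_nonneg_left h2.2 hK'
  have a3 := mul_nonneg (sub_nonneg.2 hγ) h1.1
  have a4 := mul_nonneg hK' h2.1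
  simp only [complementaryLoss, cumulativeLoss]
  constructor <;> linarith

theorem measurable_loss (hL : ∀ y, LipschitzWith L (fun z => ℓ z y)) (y : Fin K) :
    Measurable fun w => ℓ w y := (hL y).continuous.measurable

theorem measurable_complementaryLoss {X : Type*} [MeasurableSpace X]
    (hL : ∀ y, LipschitzWith L (fun z => ℓ z y)) (γ : ℝ) (c : ℕ) :
    Measurable (Function.uncurry fun (z : X × Finset (Fin K)) w =>
      complementaryLoss ℓ γ c z.2 w) := by
  have h : Measurable fun p : EuclideanSpace ℝ (Fin K) × Finset (Fin K) =>
      complementaryLoss ℓ γ c p.2 p.1 :=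
    measurable_from_prod_countable_left fun Y => by
      have := measurable_loss hL
      simp only [complementaryLoss, cumulativeLoss]
      fun_prop
  exact h.comp (measurable_snd.prodMk (measurable_snd.comp measurable_fst))

end Losses

/-! ### Unbiasedness of the MCUL risk. -/

section Risk

variable {X : Type*} {K : ℕ} {ℓ : EuclideanSpace ℝ (Fin K) → Fin K → ℝ}

/-- Merging the two sums over the sample of index `c` makes each of the `K` samples contribute a
single empirical mean, hence a single use of the deviation bound. -/
theorem empiricalRisk_eq (γ : ℝ) (α : ℕ → ℝ) {nu : ℕ} (xu : Fin nu → X) {n : ℕ → ℕ}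
    (z : (c : ℕ) → Fin (n c) → X × Finset (Fin K)) (g : X → EuclideanSpace ℝ (Fin K)) :
    empiricalRisk ℓ γ α xu z g = γ * ((∑ i, cumulativeLoss ℓ (g (xu i))) / nu)
      + ∑ c ∈ Finset.Icc 1 (K - 1),
        α c * ((∑ i, complementaryLoss ℓ γ c (z c i).2 (g (z c i).1)) / n c) := by
  rw [empiricalRisk, add_sub_assoc, ← Finset.sum_sub_distrib]
  congr 1
  · ring
  · refine Finset.sum_congr rfl fun c _ => ?_
    simp only [complementaryLoss]
    rw [Finset.sum_sub_distrib, ← Finset.mul_sum, ← Finset.mul_sum]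
    ring

variable [MeasurableSpace X]

/-- The risk as the expectation of the MCUL risk. -/
theorem risk_eq (D : Measure (X × Fin K)) [IsProbabilityMeasure D] {L : ℝ≥0} {C γ : ℝ}
    {α : ℕ → ℝ} (hα1 : ∑ c ∈ Finset.Icc 1 (K - 1), α c = 1)
    (hL : ∀ y, LipschitzWith L (fun z => ℓ z y)) {g : X → EuclideanSpace ℝ (Fin K)}
    (hg : Measurable g) (h0 : ∀ z y, 0 ≤ ℓ z y) (hC : ∀ x y, ℓ (g x) y ≤ C) :
    risk D ℓ g = γ * ∫ x, cumulativeLoss ℓ (g x) ∂(marginal D)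
      + ∑ c ∈ Finset.Icc 1 (K - 1),
        α c * ∫ z, complementaryLoss ℓ γ c z.2 (g z.1) ∂(compLaw D c) := by
  have hm (y) : Measurable fun x => ℓ (g x) y := (measurable_loss hL y).comp hg
  have hB (y x) : |ℓ (g x) y| ≤ C := by rw [abs_of_nonneg (h0 _ _)]; exact hC x y
  have hcm : Measurable fun x => cumulativeLoss ℓ (g x) :=
    Finset.measurable_sum _ fun y _ => hm y
  have hsum (Y : Finset (Fin K)) (x : X) : |∑ y ∈ Y, ℓ (g x) y| ≤ K * C := by
    have := sum_mem_Icc (h0 (g x)) (hC x) Y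
    rw [abs_of_nonneg this.1]
    exact this.2
  -- Each `c` is already unbiased on its own: `(1 - γ) E 𝓛 - (E 𝓛 - R) = R - γ E 𝓛`. The weights `α
  -- c` then only form a convex combination of equal values.
  have hc {c : ℕ} (hcI : c ∈ Finset.Icc 1 (K - 1)) :
      ∫ z, complementaryLoss ℓ γ c z.2 (g z.1) ∂(compLaw D c)
        = risk D ℓ g - γ * ∫ x, cumulativeLoss ℓ (g x) ∂(marginal D) := by
    obtain ⟨hc1, hcK⟩ := Finset.mem_Icc.1 hcI
    have hmp := measurePreserving_fst_compLaw D hcK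
    have : IsProbabilityMeasure (marginal D) :=
      Measure.isProbabilityMeasure_map measurable_fst.aemeasurable
    have : IsProbabilityMeasure (compLaw D c) := hmp.hasLaw.isProbabilityMeasure
    have e1 : ∫ z, cumulativeLoss ℓ (g z.1) ∂(compLaw D c)
        = ∫ x, cumulativeLoss ℓ (g x) ∂(marginal D) :=
      hmp.hasLaw.integral_comp hcm.aestronglyMeasurable
    have e2 := integral_compLaw_sum_mem D hc1 hcK (fun y x => ℓ (g x) y) hm hB
    have hmY : Measurable fun p : X × Finset (Fin K) => ∑ y ∈ p.2, ℓ (g p.1) y :=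
      measurable_from_prod_countable_left fun Y => Finset.measurable_sum Y fun y _ => hm y
    simp only [complementaryLoss]
    rw [integral_sub, integral_const_mul, integral_const_mul, e1, e2]
    · have hc0 : (c : ℝ) ≠ 0 := by exact_mod_cast (by omega : c ≠ 0)
      have hK0 : (K : ℝ) - 1 ≠ 0 := by
        have : (2 : ℝ) ≤ K := by exact_mod_cast (by omega : 2 ≤ K)
        linarith
      change _ - _ * (_ * (∫ x, cumulativeLoss ℓ (g x) ∂(marginal D) - risk D ℓ g)) = _
      field_simp
      ring
    · exact (Integrable.of_bound (C := K * C) (hcm.comp measurable_fst).aestronglyMeasurable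
        (ae_of_all _ fun z => hsum Finset.univ z.1)).const_mul _
    · exact (Integrable.of_bound (C := K * C) hmY.aestronglyMeasurable
        (ae_of_all _ fun z => hsum _ _)).const_mul _
  rw [Finset.sum_congr rfl fun c hcI => by rw [hc hcI], ← Finset.sum_mul, hα1]
  ring

end Risk

end MCUL

theorem mainTheorem4 (K : ℕ) (hK : 2 ≤ K) (L CG : ℝ≥0) (C δ : ℝ) (hδ : 0 < δ) :
    -- the constant of the rate depends on `K`, `L`, `CG`, `C`, `δ` only
    ∃ M : ℝ, ∀ (X : Type*) [MeasurableSpace X]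
      -- the law of an instance with its class, and the function class
      (D : Measure (X × Fin K)) [IsProbabilityMeasure D]
      (G : Set (X → ℝ)) (_ : MCUL.PointwiseMeasurable G)
      (_ : ∀ m : ℕ, 1 ≤ m →
        MCUL.rademacher (MCUL.marginal D) G m ≤ ENNReal.ofReal (CG / √(m : ℝ)))
      -- the loss
      (ℓ : EuclideanSpace ℝ (Fin K) → Fin K → ℝ)
      (_ : ∀ z y, 0 ≤ ℓ z y)
      (_ : ∀ g ∈ MCUL.productClass K G, ∀ x y, ℓ (g x) y ≤ C)
      (_ : ∀ y, LipschitzWith L (fun z => ℓ z y))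
      -- the weights
      (γ : ℝ) (_ : 0 ≤ γ) (_ : γ ≤ 1)
      (α : ℕ → ℝ) (_ : ∀ c ∈ Finset.Icc 1 (K - 1), 0 ≤ α c)
      (_ : ∑ c ∈ Finset.Icc 1 (K - 1), α c = 1)
      -- the samples
      (nu : ℕ) (_ : 1 ≤ nu) (n : ℕ → ℕ) (_ : ∀ c ∈ Finset.Icc 1 (K - 1), 1 ≤ n c)
      (Ω : Type*) [MeasurableSpace Ω] (P : Measure Ω) [IsProbabilityMeasure P]
      (xu : Fin nu → Ω → X) (z : (c : ℕ) → Fin (n c) → Ω → X × Finset (Fin K))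
      (_ : iIndepFun xu P) (_ : ∀ i, HasLaw (xu i) (MCUL.marginal D) P)
      (_ : ∀ c ∈ Finset.Icc 1 (K - 1), iIndepFun (z c) P)
      (_ : ∀ c ∈ Finset.Icc 1 (K - 1), ∀ i, HasLaw (z c i) (MCUL.compLaw D c) P)
      -- an optimal decision function
      (gstar : X → EuclideanSpace ℝ (Fin K))
      (_ : MCUL.IsMinimizer (MCUL.risk D ℓ) (MCUL.productClass K G) gstar),
      ∃ E : Set Ω, MeasurableSet E ∧ ENNReal.ofReal (1 - δ) ≤ P E ∧
        ∀ ω ∈ E, ∀ ghat : X → EuclideanSpace ℝ (Fin K),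
          MCUL.IsMinimizer
            (MCUL.empiricalRisk ℓ γ α (fun i => xu i ω) (fun c i => z c i ω))
            (MCUL.productClass K G) ghat →
          MCUL.risk D ℓ ghat - MCUL.risk D ℓ gstar
              ≤ MCUL.errorBound K (MCUL.marginal D) G L C γ α nu n δ ∧
          MCUL.risk D ℓ ghat - MCUL.risk D ℓ gstar
              ≤ M * (1 / √(nu : ℝ) + ∑ c ∈ Finset.Icc 1 (K - 1), 1 / √(n c : ℝ)) := by
  refine ⟨2 * K * K * (2 * K * L * CG + |C| * √(Real.log (2 * K / δ) / 2)), ?_⟩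
  intro X _ D _ G hG hR ℓ h0 hC hL γ hγ hγ1 α hα hα1 nu hnu n hn Ω _ P _ xu z hxu hxul hz hzl
    gstar hstar
  have hK' : (2 : ℝ) ≤ K := by exact_mod_cast hK
  have : Nonempty (Fin K) := ⟨⟨0, by omega⟩⟩
  have hμ : IsProbabilityMeasure (MCUL.marginal D) :=
    Measure.isProbabilityMeasure_map measurable_fst.aemeasurable
  obtain ⟨x₀⟩ : Nonempty X := (MCUL.marginal D).nonempty_of_neZero
  have hC0 : 0 ≤ C := (h0 _ _).trans (hC gstar hstar.1 x₀ ⟨0, by omega⟩)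
  obtain ⟨hEB0, hEBM⟩ := MCUL.errorBound_nonneg_and_le (δ := δ) hK hC0 hγ hγ1 hα hα1 hnu hn hR
  -- The samples are only a.e. measurable, so the exceptional set need not be measurable; it is
  -- enlarged to a measurable hull of equal measure.
  suffices h : ∃ N : Set Ω, P N ≤ ENNReal.ofReal δ ∧ ∀ ω ∉ N, ∀ ghat : X → EuclideanSpace ℝ (Fin K),
      MCUL.IsMinimizer (MCUL.empiricalRisk ℓ γ α (fun i => xu i ω) (fun c i => z c i ω))
        (MCUL.productClass K G) ghat →
      MCUL.risk D ℓ ghat - MCUL.risk D ℓ gstar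
        ≤ MCUL.errorBound K (MCUL.marginal D) G L C γ α nu n δ by
    obtain ⟨N, hN, h⟩ := h
    refine ⟨(toMeasurable P N)ᶜ, (measurableSet_toMeasurable P N).compl, ?_, fun ω hω ghat hg => ?_⟩
    · rw [prob_compl_eq_one_sub (measurableSet_toMeasurable P N), measure_toMeasurable,
        ENNReal.ofReal_sub _ hδ.le, ENNReal.ofReal_one]
      exact tsub_le_tsub_left hN _
    · have := h ω (fun hN => hω (subset_toMeasurable P N hN)) ghat hg
      exact ⟨this, this.trans hEBM⟩
  rcases le_or_gt 1 δ with hδ1 | hδ1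
  · refine ⟨Set.univ, ?_, fun ω hω => absurd (Set.mem_univ ω) hω⟩
    rw [measure_univ]
    exact ENNReal.one_le_ofReal.2 hδ1
  -- The deviation bounds need a range of positive length. If `C = 0` the loss vanishes on the class
  -- and both risks are zero.
  rcases hC0.eq_or_lt with rfl | hCpos
  · have hrisk : ∀ g ∈ MCUL.productClass K G, MCUL.risk D ℓ g = 0 := fun g hg => by
      have (p : X × Fin K) : ℓ (g p.1) p.2 = 0 := le_antisymm (hC g hg _ _) (h0 _ _)
      simp [MCUL.risk, this]
    refine ⟨∅, by simp, fun ω _ ghat hghat => ?_⟩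
    rw [hrisk _ hghat.1, hrisk _ hstar.1, sub_zero]
    exact hEB0
  -- Chosen so that `exp (-q) = δ / (2K)`: two events for each of the one unlabeled and `K - 1`
  -- complementary samples.
  set q : ℝ := Real.log (2 * K / δ) with hq
  have hq0 : 0 ≤ q := Real.log_nonneg ((one_le_div hδ).2 (by linarith))
  have hexp : Real.exp (-q) = δ / (2 * K) := by
    rw [hq, Real.exp_neg, Real.exp_log (by positivity), inv_div]
  have hfin (m : ℕ) (hm : 1 ≤ m) : MCUL.rademacher (MCUL.marginal D) G m ≠ ⊤ :=
    ne_top_of_le_ne_top ENNReal.ofReal_ne_top (hR m hm)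
  obtain ⟨Nu, hNu, hu⟩ := MCUL.exists_productClass_deviation_le (MeasurePreserving.id _) hG hnu
    (hfin nu hnu) (Λ := K * L) (a := 0) (W := K * C) (by positivity) (by positivity) hq0
    (fun _ w => MCUL.cumulativeLoss ℓ w)
    (by
      have := MCUL.measurable_loss hL
      unfold MCUL.cumulativeLoss Function.uncurry
      fun_prop)
    (fun _ w w' => MCUL.abs_sum_sub_sum_le hL Finset.univ w w')
    (fun g hg x => by
      rw [zero_add]
      exact MCUL.sum_mem_Icc (h0 _) (hC g hg _) Finset.univ) hstar.1 hxu hxul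
  have hc (c : ℕ) (hcI : c ∈ Finset.Icc 1 (K - 1)) := by
    have hmp := MCUL.measurePreserving_fst_compLaw D (Finset.mem_Icc.1 hcI).2
    have hprob : IsProbabilityMeasure (MCUL.compLaw D c) := hmp.hasLaw.isProbabilityMeasure
    have hApos : 0 < ((K : ℝ) - 1) / c + 1 - γ := by
      have hc1 : (0 : ℝ) < c := by exact_mod_cast (Finset.mem_Icc.1 hcI).1
      have : 0 < ((K : ℝ) - 1) / c := div_pos (by linarith) hc1
      linarith
    exact MCUL.exists_productClass_deviation_le hmp hG (hn c hcI)
      (hfin (n c) (hn c hcI)) (Λ := K * L * (((K : ℝ) - 1) / c + 1 - γ))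
      (W := K * C * (((K : ℝ) - 1) / c + 1 - γ)) (by positivity) (by positivity) hq0
      (fun z w => MCUL.complementaryLoss ℓ γ c z.2 w)
      (MCUL.measurable_complementaryLoss hL γ c)
      (fun z w w' => MCUL.abs_complementaryLoss_sub_le hL hγ1 (by omega) c z.2 w w')
      (fun g hg z => MCUL.complementaryLoss_mem_Icc hγ1 (by omega) c (h0 _) (hC g hg _) z.2)
      hstar.1 (hz c hcI) (hzl c hcI)
  choose! Nc hNc hc using hc
  refine ⟨Nu ∪ ⋃ c ∈ Finset.Icc 1 (K - 1), Nc c, ?_, fun ω hω ghat hghat => ?_⟩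
  · rw [hexp] at hNu hNc
    calc P (Nu ∪ ⋃ c ∈ Finset.Icc 1 (K - 1), Nc c)
        ≤ P Nu + ∑ c ∈ Finset.Icc 1 (K - 1), P (Nc c) :=
          (measure_union_le _ _).trans (by gcongr; exact measure_biUnion_finset_le _ _)
      _ ≤ ENNReal.ofReal (2 * (δ / (2 * K)))
          + ∑ _c ∈ Finset.Icc 1 (K - 1), ENNReal.ofReal (2 * (δ / (2 * K))) :=
          add_le_add hNu (Finset.sum_le_sum hNc)
      _ = ENNReal.ofReal δ := by
          rw [← ENNReal.ofReal_sum_of_nonneg fun _ _ => by positivity,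
            ← ENNReal.ofReal_add (by positivity) (Finset.sum_nonneg fun _ _ => by positivity)]
          congr 1
          rw [Finset.sum_const, Nat.card_Icc, nsmul_eq_mul, Nat.add_sub_cancel,
            Nat.cast_sub (by omega)]
          field_simp
          push_cast
          ring
  · rw [Set.mem_union, not_or] at hω
    have hωc (c) (hcI : c ∈ Finset.Icc 1 (K - 1)) : ω ∉ Nc c := fun h =>
      hω.2 (Set.mem_biUnion (s := ↑(Finset.Icc 1 (K - 1))) (Finset.mem_coe.2 hcI) h)
    have hrisk (g) (hg : g ∈ MCUL.productClass K G) := MCUL.risk_eq (γ := γ) D hα1 hL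
      (MCUL.measurable_of_mem_productClass hG.1 hg) h0 (hC g hg)
    -- Empirical minimality is used only against `g*`; the rest adds the uniform deviation at `ĝ` to
    -- Hoeffding's deviation at `g*`, which doubles the square-root terms.
    have hmin := hghat.2 gstar hstar.1
    rw [MCUL.empiricalRisk_eq, MCUL.empiricalRisk_eq] at hmin
    rw [hrisk ghat hghat.1, hrisk gstar hstar.1]
    obtain ⟨hu1, hu2⟩ := hu ω hω.1
    have hu1 := mul_le_mul_of_nonneg_left (add_le_add (hu1 ghat hghat.1) hu2) hγ
    have hc1 := Finset.sum_le_sum fun c (hcI : c ∈ Finset.Icc 1 (K - 1)) =>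
      mul_le_mul_of_nonneg_left
        (add_le_add ((hc c hcI ω (hωc c hcI)).1 ghat hghat.1) (hc c hcI ω (hωc c hcI)).2)
        (hα c hcI)
    have hsplit (a b c d : ℕ → ℝ) :
        ∑ k ∈ Finset.Icc 1 (K - 1), α k * (a k - b k + (c k - d k))
          = ∑ k ∈ Finset.Icc 1 (K - 1), α k * a k - ∑ k ∈ Finset.Icc 1 (K - 1), α k * b k
            + (∑ k ∈ Finset.Icc 1 (K - 1), α k * c k - ∑ k ∈ Finset.Icc 1 (K - 1), α k * d k) := by
      simp only [mul_add, mul_sub, Finset.sum_add_distrib, Finset.sum_sub_distrib]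
    rw [hsplit] at hc1
    simp only [id] at hu1
    have hEB : MCUL.errorBound K (MCUL.marginal D) G L C γ α nu n δ
        = γ * (4 * (K * L) * K * (MCUL.rademacher (MCUL.marginal D) G nu).toReal
            + K * C * √(q / (2 * nu)) + K * C * √(q / (2 * nu)))
          + ∑ c ∈ Finset.Icc 1 (K - 1), α c * (4 * (K * L * (((K : ℝ) - 1) / c + 1 - γ)) * K
                * (MCUL.rademacher (MCUL.marginal D) G (n c)).toReal
              + K * C * (((K : ℝ) - 1) / c + 1 - γ) * √(q / (2 * n c))
              + K * C * (((K : ℝ) - 1) / c + 1 - γ) * √(q / (2 * n c))) := by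
      rw [MCUL.errorBound, mul_add, Finset.mul_sum]
      congr 1
      · ring
      · exact Finset.sum_congr rfl fun c _ => by ring
    rw [hEB]
    linarith
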